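/- **Setting.** Let $A\in\mathbb R^{n\times n}$ and let $b\ge 1$ be an integer. A matrix $B\in\mathbb R^{n\times n}$ has *arrow-width* at most $b$ if $B_{ij}\ne 0$ with $i,j>b$ implies $|i-j|\le b$. A *$b$-arrow decomposition* of $A$ is an identity $A=\sum_{i=0}^{l}P_{\pi_i}B_iP_{\pi_i}^{\top}$, where every $B_i$ has arrow-width at most $b$ and every $P_{\pi_i}$ is the permutation matrix of a permutation $\pi_i$ of $\{1,\dots,n\}$. For $x>0$ the decomposition is *$x$-compacting* if for every $i<l$ the number of nonzero rows of $B_{i+1}$ is at most $\frac1x$ times the number of nonzero rows of $B_i$, and the same holds for the numbers of nonzero columns. It is *$x$-compacting in nonzero entries* if for every $i<l$ the number of nonzero entries of $B_{i+1}$ is at most $\frac1x$ times that of $B_i$. **Cost model ($\alpha$–$\beta$ model).** There are $p$ processors, working in rounds. In a round every processor sends at most one message and receives at most one message; a message is a finite list of words, its size is the number of words, and each word is a linear combination (with real coefficients) of words that the sender holds. Local linear computation is free. The schedule and the coefficients may depend on $A$, its decomposition and the parameters, but not on the input $X\in\mathbb R^{n\times k}$. The communication cost is $\alpha$ times the number of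 rounds (which is at least the length of any chain of dependent messages) plus $\beta$ times the maximum, over the processors, of the total size of all messages sent and received by that processor. **Theorem.** Let $c,c_1,c_2,c_3,C>0$. There is a constant $K>0$, depending only on $c,c_1,c_2,c_3,C$, such that the following holds for all $n,k\ge 0$, $b,p\ge 1$, $l\ge 0$, $s\ge 0$ and $x>0$, and for every $A\in\mathbb R^{n\times n}$ with a $b$-arrow decomposition $A=\sum_{i=0}^{l}P_{\pi_i}B_iP_{\pi_i}^{\top}$. Assume $c_1\frac nb\le p\le c_2\frac nb$, $x\ge c\log^2p$, $n\le ps$ and $s\le c_3b$, and assume that the decomposition is $x$-compacting, or that it is $x$-compacting in nonzero entries and $B_0$ has at most $Cn$ nonzero entries. Suppose that the feature matrix $X\in\mathbb R^{n\times k}$ is distributed so that the rows of $P_{\pi_0}^{\top}X$ are stored in consecutive blocks of $s$ rows, one block per processor. Then there is an algorithm in the above model that, for every $X$, computes $P_{\pi_0}^{\top}AX$, distributed in the same way, and whose communication cost is, for all $\alpha,\beta\ge 0$, at most $$K\left(\alpha\log^2p+\beta\,\frac{nk}{p}\right).$$ -/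

import Mathlib

open scoped Matrix

noncomputable section

namespace ArrowSpMM

/-! ### Arrow matrices and arrow decompositions -/

/-- `B` has arrow-width (at most) `b`: every nonzero entry lies in the first `b` rows, in the first
`b` columns, or at distance at most `b` from the diagonal (indices start at `0` here). -/
def HasArrowWidth {n : ℕ} (B : Matrix (Fin n) (Fin n) ℝ) (b : ℕ) : Prop :=
  ∀ i j : Fin n, b ≤ (i : ℕ) → b ≤ (j : ℕ) → B i j ≠ 0 → |(i : ℤ) - (j : ℤ)| ≤ (b : ℤ)

/-- A `b`-arrow decomposition `A = ∑ i, P_{π i} * B i * (P_{π i})ᵀ` with `l + 1` terms, numbered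
`0, …, l`. Here `(P_π) u i = 1` if `π u = i`, so `π u` is the position of `u` in the arrangement. -/
structure ArrowDecomposition {n : ℕ} (A : Matrix (Fin n) (Fin n) ℝ) (b l : ℕ) where
  /-- the permutations (linear arrangements) -/
  π : Fin (l + 1) → Equiv.Perm (Fin n)
  /-- the arrow matrices -/
  B : Fin (l + 1) → Matrix (Fin n) (Fin n) ℝ
  arrow : ∀ i, HasArrowWidth (B i) b
  sum_eq : A = ∑ i, (π i).permMatrix ℝ * B i * ((π i).permMatrix ℝ)ᵀ

/-- Number of nonzero entries. -/
def nnz {n : ℕ} (B : Matrix (Fin n) (Fin n) ℝ) : ℕ :=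
  Set.ncard {e : Fin n × Fin n | B e.1 e.2 ≠ 0}

/-- Number of nonzero rows. -/
def nonzeroRows {n : ℕ} (B : Matrix (Fin n) (Fin n) ℝ) : ℕ :=
  Set.ncard {i : Fin n | ∃ j, B i j ≠ 0}

/-- Number of nonzero columns. -/
def nonzeroCols {n : ℕ} (B : Matrix (Fin n) (Fin n) ℝ) : ℕ :=
  Set.ncard {j : Fin n | ∃ i, B i j ≠ 0}

/-- `x`-compacting, counted in nonzero entries. -/
def ArrowDecomposition.EntryCompacting {n b l : ℕ} {A : Matrix (Fin n) (Fin n) ℝ}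
    (D : ArrowDecomposition A b l) (x : ℝ) : Prop :=
  ∀ i : Fin l, (nnz (D.B i.succ) : ℝ) ≤ 1 / x * (nnz (D.B i.castSucc) : ℝ)

/-- `x`-compacting, counted in nonzero rows and nonzero columns (the two counts agree when the pattern
of nonzero entries is symmetric). -/
def ArrowDecomposition.RowColCompacting {n b l : ℕ} {A : Matrix (Fin n) (Fin n) ℝ}
    (D : ArrowDecomposition A b l) (x : ℝ) : Prop :=
  ∀ i : Fin l,
    (nonzeroRows (D.B i.succ) : ℝ) ≤ 1 / x * (nonzeroRows (D.B i.castSucc) : ℝ) ∧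
    (nonzeroCols (D.B i.succ) : ℝ) ≤ 1 / x * (nonzeroCols (D.B i.castSucc) : ℝ)

/-! ### The `α`-`β` model

There are `p` processors. A word is a linear form in the unknown input (an element of an
`ℝ`-module `W` of linear forms), so that its value on an input is one real number. A processor can
form all linear combinations of the words it holds, for free, and keeps every word it ever held.
The schedule and the coefficients may depend on everything that is fixed in advance (the matrix and
its decomposition), never on the input. -/

/-- One communication round: each processor `q` sends at most one message, the list of words
`words q`, to the processor `dest q` (nothing is sent if `dest q = none`). -/
structure Round (p : ℕ) (W : Type) where
  /-- the recipient, if any -/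
  dest : Fin p → Option (Fin p)
  /-- the content of the message -/
  words : Fin p → List W

namespace Round

variable {p : ℕ} {W : Type}

/-- Each processor receives at most one message in the round. -/
def OnePort (r : Round p W) : Prop :=
  ∀ q q' d, r.dest q = some d → r.dest q' = some d → q = q'

/-- Number of words sent by `q` in the round. -/
def sent (r : Round p W) (q : Fin p) : ℕ :=
  if (r.dest q).isSome then (r.words q).length else 0

/-- Number of words received by `q` in the round. -/
def received (r : Round p W) (q : Fin p) : ℕ :=
  ∑ q' : Fin p, if r.dest q' = some q then (r.words q').length else 0

variable [AddCommGroup W] [Module ℝ W]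

/-- Every processor sends only words that it can compute from what it holds; `H q` is the space of
the words that `q` can compute. -/
def Sendable (r : Round p W) (H : Fin p → Submodule ℝ W) : Prop :=
  ∀ q, (r.dest q).isSome → ∀ w ∈ r.words q, w ∈ H q

/-- What the processors can compute after the round. -/
def deliver (r : Round p W) (H : Fin p → Submodule ℝ W) (d : Fin p) : Submodule ℝ W :=
  H d ⊔ Submodule.span ℝ {w | ∃ q, r.dest q = some d ∧ w ∈ r.words q}

end Round

/-- A (synchronous, one-port) communication algorithm: a finite sequence of rounds. -/
abbrev Algorithm (p : ℕ) (W : Type) : Type := List (Round p W)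

namespace Algorithm

section

variable {p : ℕ} {W : Type} [AddCommGroup W] [Module ℝ W]

/-- The algorithm can be executed when the processors start with `H`. -/
def Executable : Algorithm p W → (Fin p → Submodule ℝ W) → Prop
  | [], _ => True
  | r :: rs, H => r.OnePort ∧ r.Sendable H ∧ Executable rs (r.deliver H)

/-- What the processors can compute after all rounds when they start with `H`. -/
def final : Algorithm p W → (Fin p → Submodule ℝ W) → Fin p → Submodule ℝ W
  | [], H => H
  | r :: rs, H => final rs (r.deliver H)

end

variable {p : ℕ} {W : Type}

/-- Total number of words that processor `q` sends and receives. -/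
def volume (a : Algorithm p W) (q : Fin p) : ℕ :=
  (a.map fun r => r.sent q + r.received q).sum

/-- Communication cost: `α` times the number of rounds plus `β` times the largest total volume
of a processor. The messages of a chain of dependent messages lie in different rounds, so the number
of rounds bounds the length of every such chain; it also charges a processor for messages that it
has to send or receive one after the other. -/
def cost (a : Algorithm p W) (α β : ℝ) : ℝ :=
  α * (a.length : ℝ) + β * ((Finset.univ.sup a.volume : ℕ) : ℝ)

end Algorithm

/-! ### Distributed matrices -/

/-- The linear forms in an `n × k` input matrix. -/
abbrev Form (n k : ℕ) : Type := Module.Dual ℝ (Matrix (Fin n) (Fin k) ℝ)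

/-- Entry `(i, j)` of the matrix `M * X`, as a linear form in `X`. -/
def entryForm {n k : ℕ} (M : Matrix (Fin n) (Fin n) ℝ) (i : Fin n) (j : Fin k) : Form n k where
  toFun X := (M * X) i j
  map_add' X Y := by simp [Matrix.mul_add]
  map_smul' c X := by simp

/-- `M * X` is distributed in consecutive blocks of `s` rows: processor `q` can compute the entries
of `M * X` in the rows `q * s, …, q * s + s - 1`, and their linear combinations. -/
def blockRows {n k : ℕ} (p s : ℕ) (M : Matrix (Fin n) (Fin n) ℝ) (q : Fin p) :
    Submodule ℝ (Form n k) :=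
  Submodule.span ℝ {w | ∃ (i : Fin n) (j : Fin k), (i : ℕ) / s = (q : ℕ) ∧ w = entryForm M i j}

/-- With `p` processors, starting from `M * X` and ending with `N * X` (`X` an unknown `n × k`
matrix), both distributed in blocks of `s` rows, the algorithm `a` can be executed and succeeds. -/
def Computes {n k p : ℕ} (a : Algorithm p (Form n k)) (s : ℕ) (M N : Matrix (Fin n) (Fin n) ℝ) :
    Prop :=
  a.Executable (blockRows p s M) ∧ ∀ q, blockRows p s N q ≤ a.final (blockRows p s M) q

end ArrowSpMM

end

/-! Communication is reduced to copying rows of `X`. Suppose rows can be copied so that for every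
nonzero entry `A v w` some processor holds both rows `v` and `w`. Assign the entry to such a
processor, let it multiply locally, and run the copy scheme backwards: every copy of row `v` returns
its partial sum along the edge on which it arrived, so the partial sums of row `v` add up at its
owner. This doubles the cost (`Copies.exists_forward`, `Copies.exists_backward`,
`exists_algorithm_of_copies`). The decomposition only serves to locate the nonzeros of `A`: each is
a nonzero of some `B i`.

For one arrow matrix laid out in tiles of at least `b` consecutive indices, entries near the
diagonal need an exchange between neighbouring tiles, and the arms need a broadcast of the first `b`
rows along a binary tree (`copies_arrow`). For `B 0` the tiles are `⌈c₂⌉` consecutive blocks. The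
later matrices are treated all at once: only their nonzero rows and columns are kept, and these
active indices are packed one matrix after another into a single layout, so that the trees of
different matrices are disjoint and the number of rounds does not depend on `l`.

The rows must still be carried from the first arrangement into the packed one. There are `N = O(n /
x)` tokens to move, by a geometric series, hence `O(s / log² p)` per processor on average. Helpers
even out the load at both ends (`exists_helpers`), and the balanced problem is routed on a Beneš
network in `O(log p)` rounds (`Routes.logarithmic`); the splitting in the Beneš recursion is a
two-colouring of the edges of a bipartite multigraph of maximum degree two (`exists_properOn`). If
`s` is below `log² p`, rounding the average up to an integer would be too expensive; then the load
is bounded and the tokens are sent directly (`Routes.direct`). If `log² p` is below a constant, so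
is `p`, and all rows go everywhere (`copies_all`). -/

namespace ArrowSpMM

/-! ### Copy schemes -/

/-- One round in which rows (elements of `U`) are copied between processors: `q` sends the rows
`rows q` to `d` if `snd q d`, and `V` bounds the number of rows sent and received. -/
structure IsCopyRound {p : ℕ} {U : Type} (snd : Fin p → Fin p → Prop) (rows : Fin p → Finset U)
    (S S' : Fin p → Set U) (V : Fin p → ℕ) : Prop where
  functional : ∀ q d d', snd q d → snd q d' → d = d'
  injective : ∀ q q' d, snd q d → snd q' d → q = q'
  rows_subset : ∀ q d, snd q d → ↑(rows q) ⊆ S q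
  subset_next : ∀ d, ∀ u ∈ S' d, u ∈ S d ∨ ∃ q, snd q d ∧ u ∈ rows q
  -- The two directions are bounded separately because they trade places when the round is reversed.
  volume_le : ∃ out inp : Fin p → ℕ, (∀ q, out q + inp q ≤ V q) ∧
    (∀ q d, snd q d → (rows q).card ≤ out q) ∧ ∀ q d, snd q d → (rows q).card ≤ inp d

/-- Starting from the distribution `S`, the distribution `S'` of rows can be reached in `R` rounds
of copying in which processor `q` sends and receives at most `V q` rows. -/
inductive Copies {p : ℕ} {U : Type} :
    (Fin p → Set U) → ℕ → (Fin p → ℕ) → (Fin p → Set U) → Prop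
  | refl {S S' : Fin p → Set U} (R : ℕ) (V : Fin p → ℕ) (h : S' ≤ S) : Copies S R V S'
  | step {S S₁ S' : Fin p → Set U} {R : ℕ} {V₁ V₂ : Fin p → ℕ}
      (snd : Fin p → Fin p → Prop) (rows : Fin p → Finset U)
      (h : IsCopyRound snd rows S S₁ V₁) (h' : Copies S₁ R V₂ S') :
      Copies S (R + 1) (V₁ + V₂) S'

/-! ### Running algorithms one after another, and turning copy schemes into algorithms -/

namespace Algorithm

variable {p : ℕ} {W : Type} [AddCommGroup W] [Module ℝ W]

theorem executable_append (a a' : Algorithm p W) (H : Fin p → Submodule ℝ W) :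
    Algorithm.Executable (a ++ a') H ↔ a.Executable H ∧ a'.Executable (a.final H) := by
  induction a generalizing H with
  | nil => simp [Executable, final]
  | cons r rs ih =>
    rw [List.cons_append]
    simp only [Executable, final]
    rw [ih]
    tauto

theorem final_append (a a' : Algorithm p W) (H : Fin p → Submodule ℝ W) :
    Algorithm.final (a ++ a') H = a'.final (a.final H) := by
  induction a generalizing H with
  | nil => simp [final]
  | cons r rs ih =>
    rw [List.cons_append]
    simp only [final]
    rw [ih]

theorem volume_append {p : ℕ} {W : Type} (a a' : Algorithm p W) (q : Fin p) :
    Algorithm.volume (a ++ a') q = a.volume q + a'.volume q := by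
  simp [volume]

end Algorithm

/-- A partial matching of senders and recipients is realized by a round. -/
theorem exists_round {p : ℕ} {W : Type} [AddCommGroup W] [Module ℝ W]
    (snd : Fin p → Fin p → Prop) (words : Fin p → List W)
    (hf : ∀ q d d', snd q d → snd q d' → d = d')
    (hi : ∀ q q' d, snd q d → snd q' d → q = q') (H : Fin p → Submodule ℝ W)
    (hw : ∀ q d, snd q d → ∀ w ∈ words q, w ∈ H q)
    (out inp : Fin p → ℕ) (ho : ∀ q d, snd q d → (words q).length ≤ out q)
    (hin : ∀ q d, snd q d → (words q).length ≤ inp d) :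
    ∃ r : Round p W, r.OnePort ∧ r.Sendable H ∧
      (∀ q, r.sent q + r.received q ≤ out q + inp q) ∧
      ∀ q d, snd q d → ∀ w ∈ words q, w ∈ r.deliver H d := by
  classical
  let dest : Fin p → Option (Fin p) := fun q => if h : ∃ d, snd q d then some h.choose else none
  have hd : ∀ q d, dest q = some d ↔ snd q d := by
    intro q d
    by_cases h : ∃ d, snd q d
    · have h1 : dest q = some h.choose := dif_pos h
      rw [h1, Option.some_inj]
      exact ⟨fun e => e ▸ h.choose_spec, fun e => hf q _ _ h.choose_spec e⟩
    · have h1 : dest q = none := dif_neg h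
      rw [h1]
      exact ⟨fun e => by simp at e, fun e => absurd ⟨d, e⟩ h⟩
  refine ⟨⟨dest, words⟩, ?_, ?_, ?_, ?_⟩
  · intro q q' d h h'
    exact hi q q' d ((hd _ _).1 h) ((hd _ _).1 h')
  · intro q h
    obtain ⟨d, h⟩ := Option.isSome_iff_exists.1 h
    exact hw q d ((hd _ _).1 h)
  · intro q
    refine add_le_add ?_ ?_
    · unfold Round.sent
      split_ifs with h
      · obtain ⟨d, h⟩ := Option.isSome_iff_exists.1 h
        exact ho q d ((hd _ _).1 h)
      · exact Nat.zero_le _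
    · unfold Round.received
      by_cases h : ∃ q', snd q' q
      · obtain ⟨q', h⟩ := h
        rw [Finset.sum_eq_single q']
        · rw [if_pos ((hd _ _).2 h)]
          exact hin _ _ h
        · intro q'' _ hne
          rw [if_neg]
          intro e
          exact hne (hi _ _ _ ((hd _ _).1 e) h)
        · simp
      · rw [Finset.sum_eq_zero]
        · exact Nat.zero_le _
        · intro q' _
          rw [if_neg]
          exact fun e => h ⟨q', (hd _ _).1 e⟩
  · intro q d h w hwq
    exact Submodule.mem_sup_right (Submodule.subset_span ⟨q, (hd _ _).2 h, hwq⟩)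

/-- The list of words attached to a finite set of rows. -/
noncomputable def rowWords {U W : Type} {k : ℕ} (f : U → Fin k → W) (s : Finset U) : List W :=
  (s ×ˢ (Finset.univ : Finset (Fin k))).toList.map fun e => f e.1 e.2

theorem length_rowWords {U W : Type} {k : ℕ} (f : U → Fin k → W) (s : Finset U) :
    (rowWords f s).length = s.card * k := by
  simp [rowWords]

theorem mem_rowWords {U W : Type} {k : ℕ} {f : U → Fin k → W} {s : Finset U} {w : W} :
    w ∈ rowWords f s ↔ ∃ u ∈ s, ∃ j, f u j = w := by
  simp [rowWords]

/-- A copy scheme is an algorithm that copies words. -/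
theorem Copies.exists_forward {p k : ℕ} {U W : Type} [AddCommGroup W] [Module ℝ W]
    {S S' : Fin p → Set U} {R : ℕ} {V : Fin p → ℕ} (h : Copies S R V S')
    (f : U → Fin k → W) (H : Fin p → Submodule ℝ W) (hH : ∀ q, ∀ u ∈ S q, ∀ j, f u j ∈ H q) :
    ∃ a : Algorithm p W, a.length ≤ R ∧ (∀ q, a.volume q ≤ V q * k) ∧ a.Executable H ∧
      ∀ q, ∀ u ∈ S' q, ∀ j, f u j ∈ a.final H q := by
  induction h generalizing H with
  | refl R V h =>
    refine ⟨[], by simp, by simp [Algorithm.volume], trivial, ?_⟩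
    exact fun q u hu j => hH q u (h q hu) j
  | @step S S₁ S' R V₁ V₂ snd rows h h' ih =>
    obtain ⟨out, inp, hV, ho, hi⟩ := h.volume_le
    obtain ⟨r, hr1, hr2, hr3, hr4⟩ := exists_round snd (fun q => rowWords f (rows q))
      h.functional h.injective H
      (by
        intro q d hq w hw
        obtain ⟨u, hu, j, rfl⟩ := mem_rowWords.1 hw
        exact hH q u (h.rows_subset q d hq hu) j)
      (fun q => out q * k) (fun q => inp q * k)
      (fun q d hq => by
        rw [length_rowWords]; exact Nat.mul_le_mul_right _ (ho q d hq))
      (fun q d hq => by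
        rw [length_rowWords]; exact Nat.mul_le_mul_right _ (hi q d hq))
    obtain ⟨a, ha1, ha2, ha3, ha4⟩ := ih (r.deliver H) (by
      intro d u hu j
      rcases h.subset_next d u hu with hu | ⟨q, hq, hu⟩
      · exact Submodule.mem_sup_left (hH d u hu j)
      · exact hr4 q d hq _ (mem_rowWords.2 ⟨u, hu, j, rfl⟩))
    refine ⟨r :: a, by simpa using ha1, ?_, ⟨hr1, hr2, ha3⟩, ha4⟩
    intro q
    have h1 : Algorithm.volume (r :: a) q = r.sent q + r.received q + a.volume q := by
      simp [Algorithm.volume]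
    rw [h1, Pi.add_apply, add_mul]
    refine add_le_add ((hr3 q).trans ?_) (ha2 q)
    rw [← add_mul]
    exact Nat.mul_le_mul_right _ (hV q)

/-- Run backwards, a copy scheme sums up contributions to the rows. -/
theorem Copies.exists_backward {p k : ℕ} {U W : Type} [AddCommGroup W] [Module ℝ W]
    {S S' : Fin p → Set U} {R : ℕ} {V : Fin p → ℕ} (h : Copies S R V S')
    (H : Fin p → Submodule ℝ W) (Z : Fin p → U → Fin k → W) (hZ : ∀ q u j, Z q u j ∈ H q)
    (hZ' : ∀ q u j, u ∉ S' q → Z q u j = 0) :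
    ∃ a : Algorithm p W, a.length ≤ R ∧ (∀ q, a.volume q ≤ V q * k) ∧ a.Executable H ∧
      ∃ Y : Fin p → U → Fin k → W, (∀ q u j, Y q u j ∈ a.final H q) ∧
        (∀ q u j, u ∉ S q → Y q u j = 0) ∧ ∀ u j, ∑ q, Y q u j = ∑ q, Z q u j := by
  classical
  induction h generalizing H Z with
  | refl R V h =>
    refine ⟨[], by simp, by simp [Algorithm.volume], trivial, Z, hZ, ?_, fun _ _ => rfl⟩
    exact fun q u j hu => hZ' q u j fun hu' => hu (h q hu')
  | @step S S₁ S' R V₁ V₂ snd rows h h' ih =>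
    obtain ⟨a, ha1, ha2, ha3, Y, hY1, hY2, hY3⟩ := ih H Z hZ hZ'
    obtain ⟨out, inp, hV, ho, hi⟩ := h.volume_le
    -- `src d` is what `d` received in the forward round, hence what it returns in the reversed one.
    let src : Fin p → Finset U := fun d => if h : ∃ q, snd q d then rows h.choose else ∅
    have hsrc : ∀ q d, snd q d → src d = rows q := by
      intro q d hq
      have h1 : ∃ q, snd q d := ⟨q, hq⟩
      have h2 : src d = rows h1.choose := dif_pos h1
      rw [h2, h.injective _ _ _ h1.choose_spec hq]
    obtain ⟨r, hr1, hr2, hr3, hr4⟩ := exists_round (fun d q => snd q d)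
      (fun d => rowWords (Y d) (src d))
      (fun d q q' h1 h2 => h.injective q q' d h1 h2) (fun d d' q h1 h2 => h.functional q d d' h1 h2)
      (a.final H)
      (by
        intro d q hq w hw
        obtain ⟨u, hu, j, rfl⟩ := mem_rowWords.1 hw
        exact hY1 d u j)
      (fun q => inp q * k) (fun q => out q * k)
      (fun d q hq => by
        rw [length_rowWords, hsrc q d hq]; exact Nat.mul_le_mul_right _ (hi q d hq))
      (fun d q hq => by
        rw [length_rowWords, hsrc q d hq]; exact Nat.mul_le_mul_right _ (ho q d hq))
    refine ⟨a ++ [r], by simpa using ha1, ?_, ?_, ?_⟩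
    · intro q
      rw [Algorithm.volume_append, Pi.add_apply, add_mul, add_comm]
      have h1 : Algorithm.volume [r] q = r.sent q + r.received q := by
        simp [Algorithm.volume]
      rw [h1]
      refine add_le_add ((hr3 q).trans ?_) (ha2 q)
      rw [← add_mul, add_comm]
      exact Nat.mul_le_mul_right _ (hV q)
    · rw [Algorithm.executable_append]
      exact ⟨ha3, hr1, hr2, trivial⟩
    · have hfin : Algorithm.final (a ++ [r]) H = r.deliver (a.final H) := by
        rw [Algorithm.final_append]; rfl
      rw [hfin]
      -- A returned contribution is removed from `d` and added at its source, so sums over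
      -- processors are preserved. At most one term of the subtracted sum is nonzero.
      refine ⟨fun d u j => (Y d u j - ∑ q, if snd q d ∧ u ∈ rows q then Y d u j else 0) +
        ∑ d', if snd d d' ∧ u ∈ rows d then Y d' u j else 0, ?_, ?_, ?_⟩
      · intro d u j
        have hd : Y d u j ∈ r.deliver (a.final H) d := Submodule.mem_sup_left (hY1 d u j)
        refine Submodule.add_mem _ (Submodule.sub_mem _ hd (Submodule.sum_mem _ fun q _ => ?_))
          (Submodule.sum_mem _ fun d' _ => ?_)
        · split_ifs
          · exact hd
          · exact Submodule.zero_mem _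
        · split_ifs with hc
          · refine hr4 d' d hc.1 _ (mem_rowWords.2 ⟨u, ?_, j, rfl⟩)
            rw [hsrc d d' hc.1]
            exact hc.2
          · exact Submodule.zero_mem _
      · intro d u j hu
        have h2 : ∀ d', ¬ (snd d d' ∧ u ∈ rows d) := fun d' hc => hu (h.rows_subset d d' hc.1 hc.2)
        have h3 : (∑ d', if snd d d' ∧ u ∈ rows d then Y d' u j else 0) = 0 :=
          Finset.sum_eq_zero fun d' _ => if_neg (h2 d')
        simp only [h3, add_zero]
        by_cases hc : ∃ q, snd q d ∧ u ∈ rows q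
        · obtain ⟨q, hq⟩ := hc
          rw [Finset.sum_eq_single q, if_pos hq, sub_self]
          · intro q' _ hne
            exact if_neg fun hc => hne (h.injective _ _ _ hc.1 hq.1)
          · simp
        · rw [Finset.sum_eq_zero fun q _ => if_neg fun hq => hc ⟨q, hq⟩, sub_zero]
          refine hY2 d u j fun hu' => ?_
          rcases h.subset_next d u hu' with h4 | h4
          · exact hu h4
          · exact hc h4
      · intro u j
        rw [Finset.sum_add_distrib, Finset.sum_sub_distrib, hY3,
          Finset.sum_comm (f := fun d q => if snd q d ∧ u ∈ rows q then Y d u j else 0)]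
        abel

/-! ### From copy schemes to multiplication -/

/-- The entry `(u, j)` of the input, as a word. -/
noncomputable def inputWord {n k : ℕ} (u : Fin n) (j : Fin k) : Form n k :=
  entryForm 1 u j

theorem entryForm_eq_sum {n k : ℕ} (M : Matrix (Fin n) (Fin n) ℝ) (i : Fin n) (j : Fin k) :
    entryForm M i j = ∑ u, M i u • inputWord u j := by
  ext X
  have h : ∀ u, (inputWord u j : Form n k) X = X u j := fun u => by
    show ((1 : Matrix (Fin n) (Fin n) ℝ) * X) u j = X u j
    rw [Matrix.one_mul]
  simp only [LinearMap.sum_apply, LinearMap.smul_apply, h, smul_eq_mul]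
  exact Matrix.mul_apply (M := M) (N := X)

theorem entryForm_perm_mul {n k : ℕ} (σ : Equiv.Perm (Fin n)) (M : Matrix (Fin n) (Fin n) ℝ)
    (i : Fin n) (j : Fin k) :
    entryForm ((σ.permMatrix ℝ)ᵀ * M) i j = entryForm M (σ.symm i) j := by
  have h : ∀ u, ((σ.permMatrix ℝ)ᵀ * M) i u = M (σ.symm i) u := by
    intro u
    simp only [Matrix.mul_apply, Matrix.transpose_apply, Equiv.Perm.permMatrix,
      PEquiv.toMatrix_apply, Equiv.toPEquiv_apply, Option.mem_def, Option.some_inj, ite_mul,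
      one_mul, zero_mul]
    rw [Finset.sum_eq_single (σ.symm i)]
    · simp
    · intro v _ hv
      exact if_neg fun e => hv (by rw [← e, Equiv.symm_apply_apply])
    · simp
  simp only [entryForm_eq_sum, h]

/-- If copying can bring the two rows of every nonzero entry of `A` together on some processor, then
`A * X` is computed by copying, multiplying locally, and copying backwards. -/
theorem exists_algorithm_of_copies {n k p s R V : ℕ} (A : Matrix (Fin n) (Fin n) ℝ)
    (σ : Equiv.Perm (Fin n)) (S : Fin p → Set (Fin n))
    (h : Copies (fun q => {u | (σ u : ℕ) / s = q}) R (fun _ => V) S)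
    (hS : ∀ v w, A v w ≠ 0 → ∃ t, v ∈ S t ∧ w ∈ S t) :
    ∃ a : Algorithm p (Form n k),
      Computes a s (σ.permMatrix ℝ)ᵀ ((σ.permMatrix ℝ)ᵀ * A) ∧
      ∀ α β : ℝ, 0 ≤ α → 0 ≤ β → a.cost α β ≤ α * (2 * R) + β * (2 * (V * k)) := by
  classical
  have hperm : ∀ i (j : Fin k), entryForm (σ.permMatrix ℝ)ᵀ i j = inputWord (σ.symm i) j := by
    intro i j
    have := entryForm_perm_mul σ 1 i j
    rwa [mul_one] at this
  obtain ⟨a, ha1, ha2, ha3, ha4⟩ := h.exists_forward (k := k) inputWord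
    (blockRows p s (σ.permMatrix ℝ)ᵀ) (by
      intro q u hu j
      refine Submodule.subset_span ⟨σ u, j, hu, ?_⟩
      rw [hperm, Equiv.symm_apply_apply])
  choose t ht1 ht2 using hS
  set H := a.final (blockRows p s (σ.permMatrix ℝ)ᵀ) with hH
  -- Each nonzero entry is used by exactly one processor, its `t v w`, which holds the input row `w`
  -- and may contribute to row `v`.
  let Z : Fin p → Fin n → Fin k → Form n k := fun q v j =>
    ∑ w, if ∃ h : A v w ≠ 0, t v w h = q then A v w • inputWord w j else 0
  obtain ⟨a', hb1, hb2, hb3, Y, hY1, hY2, hY3⟩ := h.exists_backward H Z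
    (by
      intro q v j
      refine Submodule.sum_mem _ fun w _ => ?_
      split_ifs with hc
      · exact Submodule.smul_mem _ _ (ha4 q w (hc.choose_spec ▸ ht2 v w hc.choose) j)
      · exact Submodule.zero_mem _)
    (by
      intro q v j hv
      refine Finset.sum_eq_zero fun w _ => if_neg fun hc => hv ?_
      exact hc.choose_spec ▸ ht1 v w hc.choose)
  refine ⟨a ++ a', ⟨?_, ?_⟩, ?_⟩
  · rw [Algorithm.executable_append]
    exact ⟨ha3, hb3⟩
  · intro q
    rw [Algorithm.final_append]
    refine Submodule.span_le.2 ?_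
    rintro _ ⟨i, j, hi, rfl⟩
    have h1 : entryForm ((σ.permMatrix ℝ)ᵀ * A) i j = Y q (σ.symm i) j := by
      rw [entryForm_perm_mul]
      -- In the initial distribution row `σ.symm i` has a single owner, so its share is the whole
      -- sum.
      have h2 : ∑ q', Y q' (σ.symm i) j = Y q (σ.symm i) j := by
        refine Finset.sum_eq_single q (fun q' _ hne => hY2 q' _ j ?_) (by simp)
        intro h3
        rw [Set.mem_ofPred_eq, Equiv.apply_symm_apply] at h3
        exact hne (Fin.ext (h3.symm.trans hi))
      rw [← h2, hY3, Finset.sum_comm, entryForm_eq_sum]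
      refine Finset.sum_congr rfl fun w _ => ?_
      by_cases hA : A (σ.symm i) w = 0
      · simp [hA]
      · rw [Finset.sum_eq_single (t (σ.symm i) w hA)]
        · simp [hA]
        · intro q' _ hne
          exact if_neg fun hc => hne hc.choose_spec.symm
        · simp
    rw [SetLike.mem_coe, h1]
    exact hY1 q _ j
  · intro α β hα hβ
    refine add_le_add (mul_le_mul_of_nonneg_left ?_ hα) (mul_le_mul_of_nonneg_left ?_ hβ)
    · have : (a ++ a').length ≤ 2 * R := by
        rw [List.length_append]; omega
      exact_mod_cast this
    · have : Finset.univ.sup (Algorithm.volume (a ++ a')) ≤ 2 * (V * k) := by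
        refine Finset.sup_le fun q _ => ?_
        rw [Algorithm.volume_append]
        have := ha2 q
        have := hb2 q
        omega
      exact_mod_cast this

end ArrowSpMM

namespace ArrowSpMM

/-! ### Composition of copy schemes -/

section Composition

variable {p : ℕ} {U : Type} {S S' S'' : Fin p → Set U} {R R' : ℕ} {V V' : Fin p → ℕ}

theorem Copies.mono (h : Copies S R V S') (hR : R ≤ R') (hV : V ≤ V') (hS : S'' ≤ S') :
    Copies S R' V' S'' := by
  induction h generalizing R' V' with
  | refl R V h => exact Copies.refl _ _ (hS.trans h)
  | @step S S₁ S' R V₁ V₂ snd rows h h' ih =>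
    obtain ⟨R'', rfl⟩ : ∃ R'', R' = R'' + 1 := ⟨R' - 1, by omega⟩
    have h1 : V' = V₁ + (V' - V₁) := by
      funext q
      have := hV q
      simp only [Pi.add_apply, Pi.sub_apply] at this ⊢
      omega
    rw [h1]
    refine Copies.step snd rows h (ih (by omega) ?_ hS)
    intro q
    have := hV q
    simp only [Pi.add_apply, Pi.sub_apply] at this ⊢
    omega

/-- Copying deletes nothing, so further rows can be carried along. This allows schemes with the same
starting distribution to be run in succession. -/
theorem Copies.frame (h : Copies S R V S') (T : Fin p → Set U) :
    Copies (S ⊔ T) R V (S' ⊔ T) := by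
  induction h with
  | refl R V h => exact Copies.refl _ _ (sup_le_sup_right h T)
  | step snd rows h h' ih =>
    refine Copies.step snd rows ⟨h.functional, h.injective, ?_, ?_, h.volume_le⟩ ih
    · exact fun q d hq => (h.rows_subset q d hq).trans (fun _ => Or.inl)
    · rintro d u (hu | hu)
      · rcases h.subset_next d u hu with hu | hu
        · exact Or.inl (Or.inl hu)
        · exact Or.inr hu
      · exact Or.inl (Or.inr hu)

theorem Copies.keep (h : Copies S R V S') : Copies S R V (S ⊔ S') := by
  have := h.frame S
  rwa [sup_idem, sup_comm] at this

theorem Copies.mono_left (h : Copies S R V S') (hT : S ≤ T) : Copies T R V S' := by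
  have := h.frame T
  rw [sup_eq_right.2 hT] at this
  exact this.mono le_rfl le_rfl le_sup_left

theorem Copies.trans (h : Copies S R V S') (h' : Copies S' R' V' S'') :
    Copies S (R + R') (V + V') S'' := by
  induction h generalizing R' V' with
  | refl R V h =>
    exact (h'.mono_left h).mono (Nat.le_add_left _ _) le_add_self le_rfl
  | @step S S₁ S' R V₁ V₂ snd rows h _ ih =>
    exact (Copies.step snd rows h (ih h')).mono (by omega) (by rw [add_assoc]) le_rfl

theorem Copies.of_round {snd : Fin p → Fin p → Prop} {rows : Fin p → Finset U}
    (h : IsCopyRound snd rows S S' V) : Copies S 1 V S' :=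
  Copies.step (V₂ := 0) snd rows h (Copies.refl 0 0 le_rfl)

/-- A single round in which every sender sends at most `m` rows. -/
theorem copies_round (S : Fin p → Set U) (snd : Fin p → Fin p → Prop) (rows : Fin p → Finset U)
    (m : ℕ) (hf : ∀ q d d', snd q d → snd q d' → d = d')
    (hi : ∀ q q' d, snd q d → snd q' d → q = q') (hS : ∀ q d, snd q d → ↑(rows q) ⊆ S q)
    (hm : ∀ q, (rows q).card ≤ m) :
    Copies S 1 (fun _ => 2 * m) (fun d => S d ∪ {u | ∃ q, snd q d ∧ u ∈ rows q}) :=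
  Copies.of_round ⟨hf, hi, hS, fun _ _ => id, fun _ => m, fun _ => m, fun _ => (two_mul m).ge,
    fun q _ _ => hm q, fun q _ _ => hm q⟩

end Composition

/-! ### Broadcasting and gathering in disjoint intervals of processors -/

section Tree

variable {p : ℕ} {U ι : Type}

/-- The intervals `[a i, a i + len i)` are pairwise disjoint. -/
def DisjointIntervals {ι : Type} (a len : ι → ℕ) : Prop :=
  ∀ i i' x, a i ≤ x → x < a i + len i → a i' ≤ x → x < a i' + len i' → i = i'

/-- The edges from the nodes of depth `J` to their children with number `c` (`c = 1, 2`) in the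
binary trees on the intervals. -/
def TreeEdge (a len : ι → ℕ) (J c : ℕ) (q d : Fin p) : Prop :=
  ∃ i o, Nat.log 2 (o + 1) = J ∧ 2 * o + c < len i ∧ (q : ℕ) = a i + o ∧
    (d : ℕ) = a i + (2 * o + c)

/-- The depth of a processor in the binary tree on its interval. -/
noncomputable def treeDepth (a len : ι → ℕ) (t : ℕ) : ℕ := by
  classical
  -- Processors outside all intervals get the default depth `0`; they lie on no tree edge, so this
  -- can only enlarge a volume bound.
  exact if h : ∃ i, a i ≤ t ∧ t < a i + len i then Nat.log 2 (t - a h.choose + 1) else 0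

theorem treeDepth_eq {a len : ι → ℕ} (h : DisjointIntervals a len) {i : ι} {o : ℕ}
    (ho : o < len i) : treeDepth a len (a i + o) = Nat.log 2 (o + 1) := by
  have h1 : ∃ i', a i' ≤ a i + o ∧ a i + o < a i' + len i' := ⟨i, by omega, by omega⟩
  have h2 : h1.choose = i :=
    h _ _ (a i + o) h1.choose_spec.1 h1.choose_spec.2 (by omega) (by omega)
  unfold treeDepth
  rw [dif_pos h1, h2]
  congr 2
  omega

/-- Offsets are numbered as in a binary heap: `2 * o + 2` and `2 * o + 3` both have half `o + 1`, so
the depth grows by one. -/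
theorem log_child (o c : ℕ) (hc : c = 1 ∨ c = 2) :
    Nat.log 2 (2 * o + c + 1) = Nat.log 2 (o + 1) + 1 := by
  rw [Nat.log_of_one_lt_of_le (by norm_num) (by omega)]
  congr 2
  omega

theorem TreeEdge.functional {a len : ι → ℕ} (h : DisjointIntervals a len) {J c : ℕ}
    {q d d' : Fin p} (h1 : TreeEdge a len J c q d) (h2 : TreeEdge a len J c q d') : d = d' := by
  obtain ⟨i, o, -, h3, h4, h5⟩ := h1
  obtain ⟨i', o', -, h3', h4', h5'⟩ := h2
  obtain rfl := h i i' q (by omega) (by omega) (by omega) (by omega)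
  exact Fin.ext (by omega)

theorem TreeEdge.injective {a len : ι → ℕ} (h : DisjointIntervals a len) {J c : ℕ}
    {q q' d : Fin p} (h1 : TreeEdge a len J c q d) (h2 : TreeEdge a len J c q' d) : q = q' := by
  obtain ⟨i, o, -, h3, h4, h5⟩ := h1
  obtain ⟨i', o', -, h3', h4', h5'⟩ := h2
  obtain rfl := h i i' d (by omega) (by omega) (by omega) (by omega)
  exact Fin.ext (by omega)

/-- An upper bound for the volume of a round that uses the edges between the depths `J` and `J + 1`.
-/
noncomputable def treeVolume (p : ℕ) (a len : ι → ℕ) (m J : ℕ) (t : Fin p) : ℕ :=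
  (if treeDepth a len t = J then m else 0) + (if treeDepth a len t = J + 1 then m else 0)

/-- Broadcast: in each interval, the first processor sends at most `m` rows to all the others. -/
theorem copies_broadcast {a len : ι → ℕ} (h : DisjointIntervals a len) (S : Fin p → Set U)
    (X : ι → Finset U) (m : ℕ) (hm : ∀ i, (X i).card ≤ m)
    (hS : ∀ i (t : Fin p), (t : ℕ) = a i → 0 < len i → ↑(X i) ⊆ S t) :
    Copies S (2 * Nat.log 2 p) (fun _ => 4 * m)
      (fun t => S t ∪ {u | ∃ i, a i ≤ t ∧ (t : ℕ) < a i + len i ∧ u ∈ X i}) := by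
  classical
  have round : ∀ (J c : ℕ), (c = 1 ∨ c = 2) → ∀ T : Fin p → Set U,
      (∀ i (t : Fin p) o, (t : ℕ) = a i + o → o < len i → Nat.log 2 (o + 1) = J →
        ↑(X i) ⊆ T t) →
      Copies T 1 (treeVolume p a len m J) (fun t => T t ∪ {u | ∃ i o, (t : ℕ) = a i + (2 * o + c) ∧
        2 * o + c < len i ∧ Nat.log 2 (o + 1) = J ∧ u ∈ X i}) := by
    intro J c hc T hT
    let rows : Fin p → Finset U := fun q =>
      if h : ∃ i, a i ≤ q ∧ (q : ℕ) < a i + len i then X h.choose else ∅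
    have hrows : ∀ i (q : Fin p), a i ≤ q → (q : ℕ) < a i + len i → rows q = X i := by
      intro i q h1 h2
      have h3 : ∃ i, a i ≤ q ∧ (q : ℕ) < a i + len i := ⟨i, h1, h2⟩
      have h4 : rows q = X h3.choose := dif_pos h3
      rw [h4, h _ _ q h3.choose_spec.1 h3.choose_spec.2 h1 h2]
    refine Copies.of_round (snd := TreeEdge a len J c) (rows := rows)
      ⟨fun _ _ _ => TreeEdge.functional h, fun _ _ _ => TreeEdge.injective h, ?_, ?_, ?_⟩
    · rintro q d ⟨i, o, h1, h2, h3, h4⟩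
      rw [hrows i q (by omega) (by omega)]
      exact hT i q o h3 (by omega) h1
    · rintro d u (hu | ⟨i, o, h1, h2, h3, h4⟩)
      · exact Or.inl hu
      · refine Or.inr ⟨⟨a i + o, by omega⟩, ⟨i, o, h3, h2, rfl, h1⟩, ?_⟩
        rw [hrows i _ (by simp) (by simp only []; omega)]
        exact h4
    · refine ⟨fun t => if treeDepth a len t = J then m else 0,
        fun t => if treeDepth a len t = J + 1 then m else 0, fun _ => le_rfl, ?_, ?_⟩
      · rintro q d ⟨i, o, h1, h2, h3, h4⟩
        beta_reduce
        rw [hrows i q (by omega) (by omega), h3, treeDepth_eq h (by omega), if_pos h1]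
        exact hm i
      · rintro q d ⟨i, o, h1, h2, h3, h4⟩
        beta_reduce
        rw [hrows i q (by omega) (by omega), h4, treeDepth_eq h h2, log_child o c hc,
          if_pos (by rw [h1])]
        exact hm i
  let Y : ℕ → Fin p → Set U := fun J t =>
    S t ∪ {u | ∃ i o, (t : ℕ) = a i + o ∧ o < len i ∧ Nat.log 2 (o + 1) ≤ J ∧ u ∈ X i}
  -- Each depth costs two rounds, one per child. A processor is charged `2 * m` for the two rounds
  -- that reach its depth and `2 * m` for the two that leave it, hence `4 * m` whatever the depth of
  -- the tree.
  have main : ∀ J : ℕ, Copies S (2 * J)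
      (fun t => if treeDepth a len t < J then 4 * m else if treeDepth a len t = J then 2 * m else 0)
      (Y J) := by
    intro J
    induction J with
    | zero =>
      refine Copies.refl _ _ ?_
      rintro t u (hu | ⟨i, o, h1, h2, h3, h4⟩)
      · exact hu
      · have h5 : o = 0 := by
          by_contra h6
          have := Nat.log_pos (b := 2) (n := o + 1) (by norm_num) (by omega)
          omega
        subst h5
        exact hS i t h1 h2 h4
    | succ J ih =>
      have h1 := round J 1 (Or.inl rfl) (Y J) (fun i t o ho hl hJ u hu =>
        Or.inr ⟨i, o, ho, hl, hJ.le, hu⟩)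
      have h2 := (ih.trans h1).trans (round J 2 (Or.inr rfl) _ (fun i t o ho hl hJ u hu =>
        Or.inl (Or.inr ⟨i, o, ho, hl, hJ.le, hu⟩)))
      refine h2.mono (by omega) ?_ ?_
      · intro t
        simp only [Pi.add_apply, treeVolume]
        split_ifs <;> omega
      · rintro t u (hu | ⟨i, o, h3, h4, h5, h6⟩)
        · exact Or.inl (Or.inl (Or.inl hu))
        · rcases Nat.lt_or_ge J (Nat.log 2 (o + 1)) with h7 | h7
          · have ho : o ≠ 0 := by
              rintro rfl
              simp at h7
            -- The parity of the offset tells which of the two rounds served this node.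
            rcases Nat.even_or_odd' o with ⟨r, hr | hr⟩
            · obtain ⟨r, rfl⟩ : ∃ r', r = r' + 1 := ⟨r - 1, by omega⟩
              have h8 : o = 2 * r + 2 := by omega
              subst h8
              rw [log_child r 2 (Or.inr rfl)] at h5 h7
              exact Or.inr ⟨i, r, h3, h4, by omega, h6⟩
            · subst hr
              rw [log_child r 1 (Or.inl rfl)] at h5 h7
              exact Or.inl (Or.inr ⟨i, r, h3, h4, by omega, h6⟩)
          · exact Or.inl (Or.inl (Or.inr ⟨i, o, h3, h4, h7, h6⟩))
  refine (main (Nat.log 2 p)).mono le_rfl ?_ ?_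
  · intro t
    simp only []
    split_ifs <;> omega
  · rintro t u (hu | ⟨i, h1, h2, h3⟩)
    · exact Or.inl hu
    · exact Or.inr ⟨i, t - a i, by omega, by omega, Nat.log_mono_right (by omega), h3⟩

/-- Gathering: in each interval, the first processor collects at most `m` rows that are stored on
the others. -/
theorem copies_gather {a len : ι → ℕ} (h : DisjointIntervals a len) (S : Fin p → Set U)
    (X : ι → Finset U) (m : ℕ) (hm : ∀ i, (X i).card ≤ m) :
    Copies S (2 * Nat.log 2 p) (fun _ => 4 * m)
      (fun t => S t ∪ {u | ∃ i, (t : ℕ) = a i ∧ u ∈ X i ∧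
        ∃ t' : Fin p, a i ≤ t' ∧ (t' : ℕ) < a i + len i ∧ u ∈ S t'}) := by
  classical
  have round : ∀ (J c : ℕ), (c = 1 ∨ c = 2) → ∀ T : Fin p → Set U,
      Copies T 1 (treeVolume p a len m J) (fun t => T t ∪ {u | ∃ i o, ∃ t' : Fin p,
        (t : ℕ) = a i + o ∧ (t' : ℕ) = a i + (2 * o + c) ∧
        2 * o + c < len i ∧ Nat.log 2 (o + 1) = J ∧ u ∈ X i ∧ u ∈ T t'}) := by
    intro J c hc T
    let rows : Fin p → Finset U := fun q =>
      if h : ∃ i, a i ≤ q ∧ (q : ℕ) < a i + len i then (X h.choose).filter (· ∈ T q) else ∅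
    have hrows : ∀ i (q : Fin p), a i ≤ q → (q : ℕ) < a i + len i →
        rows q = (X i).filter (· ∈ T q) := by
      intro i q h1 h2
      have h3 : ∃ i, a i ≤ q ∧ (q : ℕ) < a i + len i := ⟨i, h1, h2⟩
      have h4 : rows q = (X h3.choose).filter (· ∈ T q) := dif_pos h3
      rw [h4, h _ _ q h3.choose_spec.1 h3.choose_spec.2 h1 h2]
    refine Copies.of_round (snd := fun q d => TreeEdge a len J c d q) (rows := rows)
      ⟨fun _ _ _ => TreeEdge.injective h, fun _ _ _ => TreeEdge.functional h, ?_, ?_, ?_⟩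
    · rintro q d ⟨i, o, h1, h2, h3, h4⟩
      rw [hrows i q (by omega) (by omega)]
      intro u hu
      exact (Finset.mem_filter.1 hu).2
    · rintro d u (hu | ⟨i, o, t', h1, h2, h3, h4, h5, h6⟩)
      · exact Or.inl hu
      · refine Or.inr ⟨t', ⟨i, o, h4, h3, h1, h2⟩, ?_⟩
        rw [hrows i _ (by omega) (by omega)]
        exact Finset.mem_filter.2 ⟨h5, h6⟩
    · refine ⟨fun t => if treeDepth a len t = J + 1 then m else 0,
        fun t => if treeDepth a len t = J then m else 0, fun _ => (add_comm _ _).le, ?_, ?_⟩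
      · rintro q d ⟨i, o, h1, h2, h3, h4⟩
        beta_reduce
        rw [hrows i q (by omega) (by omega), h4, treeDepth_eq h h2, log_child o c hc,
          if_pos (by rw [h1])]
        exact (Finset.card_filter_le _ _).trans (hm i)
      · rintro q d ⟨i, o, h1, h2, h3, h4⟩
        beta_reduce
        rw [hrows i q (by omega) (by omega), h3, treeDepth_eq h (by omega), if_pos h1]
        exact (Finset.card_filter_le _ _).trans (hm i)
  -- The tree is climbed from its deepest level: after `r` levels every wanted row has a copy at
  -- depth at most `J`.
  have main : ∀ r J : ℕ, r + J = Nat.log 2 p → ∃ T : Fin p → Set U, S ≤ T ∧ Copies S (2 * r)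
      (fun t => if J < treeDepth a len t then 4 * m else if treeDepth a len t = J then 2 * m else 0)
      T ∧ ∀ i, ∀ u ∈ X i, (∃ t' : Fin p, a i ≤ t' ∧ (t' : ℕ) < a i + len i ∧ u ∈ S t') →
        ∃ o, ∃ t : Fin p, (t : ℕ) = a i + o ∧ o < len i ∧ Nat.log 2 (o + 1) ≤ J ∧ u ∈ T t := by
    intro r
    induction r with
    | zero =>
      intro J hJ
      refine ⟨S, le_rfl, Copies.refl _ _ le_rfl, ?_⟩
      rintro i u hu ⟨t, h1, h2, h3⟩
      exact ⟨t - a i, t, by omega, by omega, by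
        rw [show J = Nat.log 2 p by omega]
        exact Nat.log_mono_right (by omega), h3⟩
    | succ r ih =>
      intro J hJ
      obtain ⟨T, hST, hT, hX⟩ := ih (J + 1) (by omega)
      have h1 := round J 1 (Or.inl rfl) T
      have h2 := round J 2 (Or.inr rfl) T
      have h2' := h2.frame (fun t => {u | ∃ i o, ∃ t' : Fin p,
        (t : ℕ) = a i + o ∧ (t' : ℕ) = a i + (2 * o + 1) ∧
        2 * o + 1 < len i ∧ Nat.log 2 (o + 1) = J ∧ u ∈ X i ∧ u ∈ T t'})
      refine ⟨_, ?_, ((hT.trans h1).trans h2').mono (by omega) ?_ le_rfl, ?_⟩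
      · exact fun t u hu => Or.inl (Or.inl (hST t hu))
      · intro t
        simp only [Pi.add_apply, treeVolume]
        split_ifs <;> omega
      · intro i u hu hu'
        obtain ⟨o, t, h3, h4, h5, h6⟩ := hX i u hu hu'
        rcases Nat.lt_or_ge J (Nat.log 2 (o + 1)) with h7 | h7
        · have ho : o ≠ 0 := by
            rintro rfl
            simp at h7
          rcases Nat.even_or_odd' o with ⟨r, hr | hr⟩
          · obtain ⟨r, rfl⟩ : ∃ r', r = r' + 1 := ⟨r - 1, by omega⟩
            have h8 : o = 2 * r + 2 := by omega
            subst h8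
            rw [log_child r 2 (Or.inr rfl)] at h5 h7
            exact ⟨r, ⟨a i + r, by omega⟩, rfl, by omega, by omega,
              Or.inl (Or.inr ⟨i, r, t, rfl, h3, h4, by omega, hu, h6⟩)⟩
          · subst hr
            rw [log_child r 1 (Or.inl rfl)] at h5 h7
            exact ⟨r, ⟨a i + r, by omega⟩, rfl, by omega, by omega,
              Or.inr ⟨i, r, t, rfl, h3, h4, by omega, hu, h6⟩⟩
        · exact ⟨o, t, h3, h4, h7, Or.inl (Or.inl h6)⟩
  obtain ⟨T, hST, hT, hX⟩ := main (Nat.log 2 p) 0 (by omega)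
  refine hT.mono le_rfl ?_ ?_
  · intro t
    simp only []
    split_ifs <;> omega
  · rintro t u (hu | ⟨i, h1, h2, h3⟩)
    · exact hST t hu
    · obtain ⟨o, t', h4, h5, h6, h7⟩ := hX i u h2 h3
      have h8 : o = 0 := by
        by_contra h9
        have := Nat.log_pos (b := 2) (n := o + 1) (by norm_num) (by omega)
        omega
      have h9 : t = t' := Fin.ext (by omega)
      rw [h9]
      exact h7

end Tree

end ArrowSpMM

namespace ArrowSpMM

/-! ### Splitting into two balanced halves -/

/-- The fibers of `f` have at most `M` elements: they can be numbered by `0, …, M - 1`. -/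
def FibersLE {T V : Type} (f : T → V) (M : ℕ) : Prop :=
  ∃ idx : T → ℕ, (∀ t, idx t < M) ∧ ∀ t t', f t = f t' → idx t = idx t' → t = t'

theorem FibersLE.mono {T V : Type} {f : T → V} {M M' : ℕ} (h : FibersLE f M) (hM : M ≤ M') :
    FibersLE f M' :=
  let ⟨idx, h1, h2⟩ := h
  ⟨idx, fun t => (h1 t).trans_le hM, h2⟩

theorem FibersLE.card_le {T V : Type} [Fintype T] [DecidableEq V] {f : T → V} {M : ℕ}
    (h : FibersLE f M) (v : V) : (Finset.univ.filter (f · = v)).card ≤ M := by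
  obtain ⟨idx, h1, h2⟩ := h
  rw [← Finset.card_range M]
  refine Finset.card_le_card_of_injOn idx (fun t _ => by simpa using h1 t) ?_
  intro t ht t' ht' e
  simp only [Finset.coe_filter, Finset.mem_univ, true_and] at ht ht'
  exact h2 t t' (Eq.trans ht (Eq.symm ht')) e

/-- No three elements of `s` lie in the same fiber of `F`. -/
def PairFibers {T α : Type} (F : T → α) (s : Finset T) : Prop :=
  ∀ x ∈ s, ∀ y ∈ s, ∀ z ∈ s, F x = F y → F x = F z → x = y ∨ x = z ∨ y = z

/-- `χ` is injective on the fibers of `F` in `s`. -/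
def ProperOn {T α : Type} (F : T → α) (χ : T → Bool) (s : Finset T) : Prop :=
  ∀ x ∈ s, ∀ y ∈ s, F x = F y → χ x = χ y → x = y

/-- The removed edge `w` already takes one of the two places in its fiber. -/
theorem PairFibers.eq_of_erase {T β : Type} [DecidableEq T] {s : Finset T} {G : T → β}
    (hG : PairFibers G s) {t t' : T} : ∀ w ∈ s, (w = t ∨ w = t') → ∀ u ∈ (s.erase t).erase t',
      ∀ u' ∈ (s.erase t).erase t', G u = G w → G u' = G w → u = u' := by
  intro w hw hw' u hu u' hu' h3 h4
  simp only [Finset.mem_erase] at hu hu'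
  rcases hG w hw u hu.2.2 u' hu'.2.2 h3.symm h4.symm with h5 | h5 | h5
  · rcases hw' with rfl | rfl
    · exact absurd h5.symm hu.2.1
    · exact absurd h5.symm hu.1
  · rcases hw' with rfl | rfl
    · exact absurd h5.symm hu'.2.1
    · exact absurd h5.symm hu'.1
  · exact h5

/-- The path formed by the edges `t`, `t'` through their common `F`-vertex is contracted: both edges
are deleted and their `G`-ends identified. At most one other edge remains at each end, and the
colouring of the contracted graph gives two such edges different colours. Hence `t` and `t'` can be
given opposite colours, each unlike the other edge at its `G`-end. -/
theorem exists_properOn_of_erase {T α β : Type} [DecidableEq T] [DecidableEq β] {s : Finset T}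
    {F : T → α} {G : T → β} (hF : PairFibers F s) (hG : PairFibers G s) {t t' : T} (ht : t ∈ s)
    (ht' : t' ∈ s) (hne : t ≠ t') (hFt : F t = F t') {χ : T → Bool}
    (h1 : ProperOn F χ ((s.erase t).erase t'))
    (h2 : ProperOn (fun z => if G z = G t' then G t else G z) χ ((s.erase t).erase t')) :
    ∃ χ : T → Bool, ProperOn F χ s ∧ ProperOn G χ s := by
  classical
  obtain ⟨b, hb1, hb2⟩ : ∃ b : Bool, (∀ u ∈ (s.erase t).erase t', G u = G t → χ u = !b) ∧
      ∀ u ∈ (s.erase t).erase t', G u = G t' → χ u = b := by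
    have huniq := hG.eq_of_erase (t := t) (t' := t')
    by_cases hu : ∃ u ∈ (s.erase t).erase t', G u = G t
    · obtain ⟨u, hu, hut⟩ := hu
      refine ⟨!χ u, fun u' hu' h3 => ?_, fun u' hu' h3 => ?_⟩
      · rw [huniq t ht (Or.inl rfl) u' hu' u hu h3 hut, Bool.not_not]
      · have h4 : u' ≠ u := by
          rintro rfl
          have hu2 := hu
          simp only [Finset.mem_erase] at hu2
          rcases hG t ht t' ht' u' hu2.2.2 (hut.symm.trans h3) hut.symm with h5 | h5 | h5
          · exact hne h5
          · exact hu2.2.1 h5.symm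
          · exact hu2.1 h5.symm
        have h5 : χ u' ≠ χ u := by
          intro h5
          refine h4 (h2 u' hu' u hu ?_ h5)
          simp only [h3, hut]
          split_ifs <;> rfl
        cases h6 : χ u <;> cases h7 : χ u' <;> simp_all
    · by_cases hu' : ∃ u ∈ (s.erase t).erase t', G u = G t'
      · obtain ⟨u', hu', hut⟩ := hu'
        refine ⟨χ u', fun u hu2 h3 => absurd ⟨u, hu2, h3⟩ hu, fun u hu2 h3 => ?_⟩
        rw [huniq t' ht' (Or.inr rfl) u hu2 u' hu' h3 hut]
      · exact ⟨true, fun u hu2 h3 => absurd ⟨u, hu2, h3⟩ hu,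
          fun u hu2 h3 => absurd ⟨u, hu2, h3⟩ hu'⟩
  have key : ∀ x ∈ s, x = t ∨ x = t' ∨ x ∈ (s.erase t).erase t' := by
    intro x hx
    simp only [Finset.mem_erase]
    tauto
  have hnt : ∀ u ∈ (s.erase t).erase t', u ≠ t ∧ u ≠ t' ∧ u ∈ s := by
    intro u hu
    simp only [Finset.mem_erase] at hu
    tauto
  let χ' : T → Bool := fun x => if x = t then b else if x = t' then !b else χ x
  have c1 : χ' t = b := if_pos rfl
  have c2 : χ' t' = !b := by simp [χ', hne.symm]
  have c3 : ∀ u ∈ (s.erase t).erase t', χ' u = χ u := by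
    intro u hu
    simp [χ', (hnt u hu).1, (hnt u hu).2.1]
  have bne : ∀ b : Bool, b ≠ !b := by decide
  have fF : ∀ u ∈ (s.erase t).erase t', F u ≠ F t := by
    intro u hu h3
    obtain ⟨h4, h5, h6⟩ := hnt u hu
    rcases hF t ht t' ht' u h6 hFt h3.symm with h7 | h7 | h7
    · exact hne h7
    · exact h4 h7.symm
    · exact h5 h7.symm
  refine ⟨χ', ?_, ?_⟩
  · intro x hx y hy hxy hχ
    rcases key x hx with rfl | rfl | hx' <;> rcases key y hy with rfl | rfl | hy'
    · rfl
    · rw [c1, c2] at hχ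
      exact absurd hχ (bne b)
    · exact absurd hxy.symm (fF y hy')
    · rw [c1, c2] at hχ
      exact absurd hχ.symm (bne b)
    · rfl
    · exact absurd (hxy.symm.trans hFt.symm) (fF y hy')
    · exact absurd hxy (fF x hx')
    · exact absurd (hxy.trans hFt.symm) (fF x hx')
    · rw [c3 x hx', c3 y hy'] at hχ
      exact h1 x hx' y hy' hxy hχ
  · intro x hx y hy hxy hχ
    rcases key x hx with rfl | rfl | hx' <;> rcases key y hy with rfl | rfl | hy'
    · rfl
    · rw [c1, c2] at hχ
      exact absurd hχ (bne b)
    · rw [c1, c3 y hy', hb1 y hy' hxy.symm] at hχ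
      exact absurd hχ (bne b)
    · rw [c1, c2] at hχ
      exact absurd hχ.symm (bne b)
    · rfl
    · rw [c2, c3 y hy', hb2 y hy' hxy.symm] at hχ
      exact absurd hχ.symm (bne b)
    · rw [c1, c3 x hx', hb1 x hx' hxy] at hχ
      exact absurd hχ.symm (bne b)
    · rw [c2, c3 x hx', hb2 x hx' hxy] at hχ
      exact absurd hχ (bne b)
    · rw [c3 x hx', c3 y hy'] at hχ
      exact h2 x hx' y hy' (by simp only [hxy]) hχ

/-- Each of the two identified vertices keeps at most one edge after the deletion, so the merged
vertex has degree at most two. -/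
theorem PairFibers.merge {T β : Type} [DecidableEq T] [DecidableEq β] {s : Finset T} {G : T → β}
    (hG : PairFibers G s) {t t' : T} (ht : t ∈ s) (ht' : t' ∈ s) :
    PairFibers (fun z => if G z = G t' then G t else G z) ((s.erase t).erase t') := by
  have huniq := hG.eq_of_erase (t := t) (t' := t')
  have h1 := huniq t ht (Or.inl rfl)
  have h2 := huniq t' ht' (Or.inr rfl)
  have hs : ∀ u ∈ (s.erase t).erase t', u ∈ s := by
    intro u hu
    simp only [Finset.mem_erase] at hu
    exact hu.2.2
  intro x hx y hy z hz hxy hxz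
  have h3 := hG x (hs x hx) y (hs y hy) z (hs z hz)
  have := h1 x hx y hy
  have := h1 x hx z hz
  have := h1 y hy z hz
  have := h2 x hx y hy
  have := h2 x hx z hz
  have := h2 y hy z hz
  clear huniq h1 h2 hs hG
  beta_reduce at hxy hxz
  grind

theorem PairFibers.subset {T α : Type} {F : T → α} {s s' : Finset T} (h : PairFibers F s)
    (hs : s' ⊆ s) : PairFibers F s' :=
  fun x hx y hy z hz => h x (hs hx) y (hs hy) z (hs hz)

/-- A bipartite multigraph of maximum degree two has a two-colouring of its edges in which edges
that share a vertex have different colours. -/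
theorem exists_properOn {T α β : Type} (s : Finset T) (F : T → α) (G : T → β)
    (hF : PairFibers F s) (hG : PairFibers G s) :
    ∃ χ : T → Bool, ProperOn F χ s ∧ ProperOn G χ s := by
  classical
  induction hm : s.card using Nat.strong_induction_on generalizing s F G with
  | _ m ih =>
    have hcard : ∀ t ∈ s, ∀ t' ∈ s, t ≠ t' → ((s.erase t).erase t').card < m := by
      intro t ht t' ht' hne
      rw [← hm]
      exact (Finset.card_le_card (Finset.erase_subset _ _)).trans_lt (Finset.card_erase_lt_of_mem ht)
    have hsub : ∀ t t', (s.erase t).erase t' ⊆ s := fun t t' =>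
      (Finset.erase_subset _ _).trans (Finset.erase_subset _ _)
    by_cases h : ∃ t ∈ s, ∃ t' ∈ s, t ≠ t' ∧ F t = F t'
    · obtain ⟨t, ht, t', ht', hne, he⟩ := h
      obtain ⟨χ, h1, h2⟩ := ih _ (hcard t ht t' ht' hne) _ F
        (fun z => if G z = G t' then G t else G z) (hF.subset (hsub t t'))
        (hG.merge ht ht') rfl
      exact exists_properOn_of_erase hF hG ht ht' hne he h1 h2
    by_cases h' : ∃ t ∈ s, ∃ t' ∈ s, t ≠ t' ∧ G t = G t'
    · obtain ⟨t, ht, t', ht', hne, he⟩ := h'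
      obtain ⟨χ, h1, h2⟩ := ih _ (hcard t ht t' ht' hne) _
        (fun z => if F z = F t' then F t else F z) G (hF.merge ht ht')
        (hG.subset (hsub t t')) rfl
      obtain ⟨χ, h3, h4⟩ := exists_properOn_of_erase hG hF ht ht' hne he h2 h1
      exact ⟨χ, h4, h3⟩
    -- No two edges share a vertex any more, so one colour is enough.
    push Not at h h'
    refine ⟨fun _ => true, ?_, ?_⟩
    · intro x hx y hy hxy _
      by_contra hne
      exact h x hx y hy hne hxy
    · intro x hx y hy hxy _
      by_contra hne
      exact h' x hx y hy hne hxy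

/-- If the fibers of `f` and `g` have at most `2 * M` elements, the tokens can be coloured with two
colours such that at most `M` elements of each fiber have the same colour. -/
theorem exists_balanced_split {T V : Type} [Finite T] {f g : T → V} {M : ℕ}
    (hf : FibersLE f (2 * M)) (hg : FibersLE g (2 * M)) :
    ∃ χ : T → Bool, FibersLE (fun t => (χ t, f t)) M ∧ FibersLE (fun t => (χ t, g t)) M := by
  have := Fintype.ofFinite T
  -- Halving the numbering groups each fiber into at most `M` pairs. A colouring that separates
  -- every pair leaves at most `M` tokens per colour, numbered by their pairs.
  have pair : ∀ (f : T → V) (idx : T → ℕ), (∀ t t', f t = f t' → idx t = idx t' → t = t') →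
      PairFibers (fun t => (f t, idx t / 2)) Finset.univ := by
    intro f idx h x _ y _ z _ hxy hxz
    simp only [Prod.mk.injEq] at hxy hxz
    by_cases h1 : idx x = idx y
    · exact Or.inl (h x y hxy.1 h1)
    by_cases h2 : idx x = idx z
    · exact Or.inr (Or.inl (h x z hxz.1 h2))
    · exact Or.inr (Or.inr (h y z (hxy.1.symm.trans hxz.1) (by omega)))
  obtain ⟨i, hi1, hi2⟩ := hf
  obtain ⟨j, hj1, hj2⟩ := hg
  obtain ⟨χ, h1, h2⟩ := exists_properOn Finset.univ _ _ (pair f i hi2) (pair g j hj2)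
  refine ⟨χ, ⟨fun t => i t / 2, fun t => ?_, fun t t' h h' => ?_⟩,
    ⟨fun t => j t / 2, fun t => ?_, fun t t' h h' => ?_⟩⟩
  · have := hi1 t
    beta_reduce
    omega
  · simp only [Prod.mk.injEq] at h
    exact h1 t (Finset.mem_univ _) t' (Finset.mem_univ _) (Prod.ext h.2 h') h.1
  · have := hj1 t
    beta_reduce
    omega
  · simp only [Prod.mk.injEq] at h
    exact h2 t (Finset.mem_univ _) t' (Finset.mem_univ _) (Prod.ext h.2 h') h.1

/-! ### Routing -/

section Routing

variable {T V : Type}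

/-- Moving the tokens from the nodes `f` to the nodes `g` uses each node at most once as a sender
and at most once as a recipient. -/
def IsMatchingMove (f g : T → V) : Prop :=
  ∀ t t', g t ≠ f t → g t' ≠ f t' → (f t = f t' ↔ g t = g t')

theorem IsMatchingMove.symm {f g : T → V} (h : IsMatchingMove f g) : IsMatchingMove g f :=
  fun t t' h1 h2 => (h t t' h1.symm h2.symm).symm

/-- The tokens can be routed from `f` to `g` in `R` rounds such that every node always holds at
most `M` tokens. -/
def Routes (M R : ℕ) (f g : T → V) : Prop :=
  ∃ pos : ℕ → T → V, pos 0 = f ∧ pos R = g ∧ (∀ j ≤ R, FibersLE (pos j) M) ∧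
    ∀ j < R, IsMatchingMove (pos j) (pos (j + 1))

theorem Routes.of_move {M : ℕ} {f g : T → V} (hf : FibersLE f M) (hg : FibersLE g M)
    (h : IsMatchingMove f g) : Routes M 1 f g := by
  refine ⟨fun j => if j = 0 then f else g, rfl, rfl, fun j _ => ?_, fun j hj => ?_⟩
  · beta_reduce
    split_ifs
    · exact hf
    · exact hg
  · obtain rfl : j = 0 := by omega
    exact h

theorem Routes.trans {M R R' : ℕ} {f g e : T → V} (h : Routes M R f g) (h' : Routes M R' g e) :
    Routes M (R + R') f e := by
  obtain ⟨pos, h1, h2, h3, h4⟩ := h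
  obtain ⟨pos', h1', h2', h3', h4'⟩ := h'
  refine ⟨fun j => if j ≤ R then pos j else pos' (j - R), ?_, ?_, fun j hj => ?_, fun j hj => ?_⟩
  · simpa using h1
  · beta_reduce
    split_ifs with h5
    · obtain rfl : R' = 0 := by omega
      rw [add_zero, h2, ← h1', h2']
    · rw [Nat.add_sub_cancel_left, h2']
  · beta_reduce
    split_ifs with h5
    · exact h3 j h5
    · exact h3' _ (by omega)
  · beta_reduce
    rcases Nat.lt_trichotomy j R with h5 | h5 | h5
    · rw [if_pos (by omega), if_pos (by omega)]
      exact h4 j h5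
    · subst h5
      rw [if_pos le_rfl, if_neg (by omega), h2, ← h1', Nat.add_sub_cancel_left]
      exact h4' 0 (by omega)
    · rw [if_neg (by omega), if_neg (by omega), Nat.sub_add_comm (by omega)]
      exact h4' _ (by omega)

theorem Routes.comp_injective {V' : Type} {M R : ℕ} {f g : T → V} (h : Routes M R f g)
    {ψ : V → V'} (hψ : Function.Injective ψ) : Routes M R (ψ ∘ f) (ψ ∘ g) := by
  obtain ⟨pos, h1, h2, h3, h4⟩ := h
  refine ⟨fun j => ψ ∘ pos j, congrArg (ψ ∘ ·) h1, congrArg (ψ ∘ ·) h2, fun j hj => ?_, fun j hj t t' h5 h6 => ?_⟩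
  · obtain ⟨idx, h5, h6⟩ := h3 j hj
    exact ⟨idx, h5, fun t t' h => h6 t t' (hψ h)⟩
  · have := h4 j hj t t' (fun h => h5 (congrArg ψ h)) (fun h => h6 (congrArg ψ h))
    simp only [Function.comp_apply, hψ.eq_iff]
    exact this

/-- Sending every token directly. -/
theorem Routes.direct {M : ℕ} {f g : T → V} (hf : FibersLE f M) (hg : FibersLE g M) :
    Routes (2 * M) (M * M) f g := by
  classical
  obtain ⟨i, hi1, hi2⟩ := hf
  obtain ⟨j, hj1, hj2⟩ := hg
  -- A token moves in the round that encodes its number at the source and its number at the target.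
  -- Within a round, tokens agree in both numbers, so sharing an endpoint means being equal.
  refine ⟨fun r t => if i t * M + j t < r then g t else f t, ?_, ?_, fun r _ => ?_,
    fun r _ t t' h h' => ?_⟩
  · funext t
    simp
  · funext t
    refine if_pos ?_
    have h1 : (i t + 1) * M ≤ M * M := Nat.mul_le_mul_right _ (hi1 t)
    rw [add_mul, one_mul] at h1
    have := hj1 t
    omega
  -- Tokens that have arrived get odd numbers and waiting ones even numbers.
  · refine ⟨fun t => if i t * M + j t < r then 2 * j t + 1 else 2 * i t, fun t => ?_,
      fun t t' h h' => ?_⟩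
    · have := hi1 t
      have := hj1 t
      beta_reduce
      split_ifs <;> omega
    · beta_reduce at h h'
      split_ifs at h h'
      · exact hj2 t t' h (by omega)
      · omega
      · omega
      · exact hi2 t t' h (by omega)
  · have key : ∀ t, (if i t * M + j t < r + 1 then g t else f t) ≠
        (if i t * M + j t < r then g t else f t) → i t * M + j t = r := by
      intro t h
      by_contra hne
      refine h ?_
      split_ifs <;> first | rfl | omega
    have e := key t h
    have e' := key t' h'
    have hj : j t = j t' := by
      have h1 : (i t * M + j t) % M = (i t' * M + j t') % M := by rw [e, e']
      rwa [Nat.mul_add_mod', Nat.mul_add_mod', Nat.mod_eq_of_lt (hj1 t), Nat.mod_eq_of_lt (hj1 t')] at h1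
    have hi : i t = i t' := by
      have h1 : i t * M = i t' * M := by omega
      exact Nat.eq_of_mul_eq_mul_right (by have := hi1 t; omega) h1
    beta_reduce
    rw [if_neg (by omega), if_neg (by omega), if_pos (by omega), if_pos (by omega)]
    exact ⟨fun h => by rw [hi2 t t' h hi], fun h => by rw [hj2 t t' h hj]⟩

/-- The Beneš recursion: a first round chooses for each token the half in which it travels, the
halves route independently and in parallel, and a last round corrects the half. A balanced split
chooses the halves so that no node ever exceeds `M` tokens. -/
theorem Routes.prod_bool {M R : ℕ} (hV : ∀ (T : Type) [Finite T] (f g : T → V), FibersLE f M →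
      FibersLE g M → Routes M R f g) [Finite T] (f g : T → Bool × V) (hf : FibersLE f M)
    (hg : FibersLE g M) : Routes M (R + 2) f g := by
  have double : ∀ f : T → Bool × V, FibersLE f M → FibersLE (fun t => (f t).2) (2 * M) := by
    rintro f ⟨idx, h1, h2⟩
    refine ⟨fun t => 2 * idx t + (f t).1.toNat, fun t => ?_, fun t t' h h' => ?_⟩
    · have := h1 t
      have := Bool.toNat_lt (f t).1
      beta_reduce
      omega
    · have h3 := Bool.toNat_lt (f t).1
      have h4 := Bool.toNat_lt (f t').1
      beta_reduce at h'
      have h5 : (f t).1.toNat = (f t').1.toNat := by omega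
      refine h2 t t' (Prod.ext ?_ h) (by omega)
      cases h6 : (f t).1 <;> cases h7 : (f t').1 <;> simp_all
  obtain ⟨χ, hχf, hχg⟩ := exists_balanced_split (double f hf) (double g hg)
  -- A moving token can only go to the node with the opposite bit, so the moves form a matching for
  -- any `χ`.
  have flip : ∀ f : T → Bool × V, IsMatchingMove f (fun t => (χ t, (f t).2)) := by
    intro f t t' h h'
    have key : ∀ t, (χ t, (f t).2) ≠ f t → χ t = !(f t).1 := by
      intro t h
      by_contra hc
      refine h (Prod.ext ?_ rfl)
      cases h1 : χ t <;> cases h2 : (f t).1 <;> simp_all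
    have e := key t h
    have e' := key t' h'
    beta_reduce
    rw [e, e', Prod.ext_iff, Prod.ext_iff]
    simp
  have sub : ∀ f : T → Bool × V, FibersLE (fun t => (χ t, (f t).2)) M → ∀ c : Bool,
      FibersLE (fun t : {t // χ t = c} => (f t).2) M := by
    rintro f ⟨idx, h1, h2⟩ c
    refine ⟨fun t => idx t, fun t => h1 t, fun t t' h h' => Subtype.ext (h2 t t' ?_ h')⟩
    exact Prod.ext (t.2.trans t'.2.symm) h
  choose pos h1 h2 h3 h4 using fun c : Bool => hV {t // χ t = c} (fun t => (f t).2)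
    (fun t => (g t).2) (sub f hχf c) (sub g hχg c)
  have mid : Routes M R (fun t => (χ t, (f t).2)) (fun t => (χ t, (g t).2)) := by
    refine ⟨fun j t => (χ t, pos (χ t) j ⟨t, rfl⟩), ?_, ?_, fun j hj => ?_,
      fun j hj t t' h h' => ?_⟩
    · funext t
      beta_reduce
      rw [h1]
    · funext t
      beta_reduce
      rw [h2]
    · choose idx h5 h6 using fun c => h3 c j hj
      refine ⟨fun t => idx (χ t) ⟨t, rfl⟩, fun t => h5 _ _, fun t t' h h' => ?_⟩
      simp only [Prod.mk.injEq] at h h'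
      obtain ⟨h7, h8⟩ := h
      have key : ∀ c c' (hc : χ t = c) (hc' : χ t' = c'), c = c' →
          pos c j ⟨t, hc⟩ = pos c' j ⟨t', hc'⟩ → idx c ⟨t, hc⟩ = idx c' ⟨t', hc'⟩ → t = t' := by
        rintro c c' hc hc' rfl h9 h10
        exact congrArg Subtype.val (h6 c _ _ h9 h10)
      exact key _ _ rfl rfl h7 h8 h'
    · have key : ∀ c c' (hc : χ t = c) (hc' : χ t' = c'),
          pos c (j + 1) ⟨t, hc⟩ ≠ pos c j ⟨t, hc⟩ → pos c' (j + 1) ⟨t', hc'⟩ ≠ pos c' j ⟨t', hc'⟩ →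
          c = c' →
          (pos c j ⟨t, hc⟩ = pos c' j ⟨t', hc'⟩ ↔
            pos c (j + 1) ⟨t, hc⟩ = pos c' (j + 1) ⟨t', hc'⟩) := by
        rintro c c' hc hc' h9 h10 rfl
        exact h4 c j hj _ _ h9 h10
      have h9 := key _ _ rfl rfl (fun e => h (Prod.ext rfl e)) (fun e => h' (Prod.ext rfl e))
      simp only [Prod.mk.injEq]
      exact and_congr_right h9
  have := ((Routes.of_move hf hχf (flip f)).trans mid).trans
    (Routes.of_move hχg hg (flip g).symm)
  rwa [show R + 2 = 1 + R + 1 by omega]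

/-- Routing on the Beneš network with `2 ^ d` nodes. -/
theorem exists_benes (d : ℕ) : ∃ (V : Type) (_ : Fintype V), Fintype.card V = 2 ^ d ∧
    ∀ (M : ℕ) (T : Type) [Finite T] (f g : T → V), FibersLE f M → FibersLE g M →
      Routes M (2 * d) f g := by
  induction d with
  | zero =>
    refine ⟨Unit, inferInstance, rfl, fun M T _ f g hf _ => ⟨fun _ => f, rfl, Subsingleton.elim _ _,
      fun _ _ => hf, ?_⟩⟩
    exact fun j hj => absurd hj (by simp)
  | succ d ih =>
    obtain ⟨V, hV, hc, h⟩ := ih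
    refine ⟨Bool × V, inferInstance, ?_, fun M T _ f g hf hg => ?_⟩
    · rw [Fintype.card_prod, hc, Fintype.card_bool, pow_succ, mul_comm]
    · rw [mul_add, mul_one]
      exact Routes.prod_bool (fun T _ f g => h M T f g) f g hf hg

/-- Every balanced routing problem on `p` processors is solved in `O(log p)` rounds. -/
theorem Routes.logarithmic {p M : ℕ} (hp : 1 ≤ p) [Finite T] {f g : T → Fin p}
    (hf : FibersLE f M) (hg : FibersLE g M) : Routes (2 * M) (2 * Nat.log 2 p + 2) f g := by
  obtain ⟨V, hV, hc, h⟩ := exists_benes (Nat.log 2 p)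
  set d := Nat.log 2 p
  have hd1 : 2 ^ d ≤ p := Nat.pow_log_le_self 2 (by omega)
  have hd2 : p < 2 ^ d * 2 := by
    rw [← pow_succ]
    exact Nat.lt_pow_succ_log_self (by norm_num) p
  let e : V ≃ Fin (2 ^ d) := Fintype.equivFinOfCardEq hc
  let ψ : V → Fin p := fun v => Fin.castLE hd1 (e v)
  have hψ : Function.Injective ψ := fun v v' h => e.injective (Fin.castLE_injective hd1 h)
  -- Since `p` is less than twice `2 ^ d`, reduction modulo `2 ^ d` folds at most two processors
  -- onto one node. This costs one round at each end and doubles the load.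
  let φ : Fin p → V := fun q => e.symm ⟨q % 2 ^ d, Nat.mod_lt _ (by positivity)⟩
  have hφ : ∀ q, ((ψ (φ q) : Fin p) : ℕ) = q % 2 ^ d := by
    intro q
    simp [ψ, φ]
  have hmod : ∀ q : Fin p, (q : ℕ) % 2 ^ d = q ∨ (q : ℕ) % 2 ^ d + 2 ^ d = q := by
    intro q
    rcases Nat.lt_or_ge q (2 ^ d) with h1 | h1
    · exact Or.inl (Nat.mod_eq_of_lt h1)
    · right
      rw [Nat.mod_eq_sub_mod h1, Nat.mod_eq_of_lt (by omega)]
      omega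
  have fold : ∀ f : T → Fin p, FibersLE f M →
      FibersLE (φ ∘ f) (2 * M) ∧ IsMatchingMove f (ψ ∘ φ ∘ f) := by
    rintro f ⟨idx, h1, h2⟩
    constructor
    · refine ⟨fun t => 2 * idx t + if (f t : ℕ) < 2 ^ d then 1 else 0, fun t => ?_,
        fun t t' h h' => ?_⟩
      · have := h1 t
        beta_reduce
        split_ifs <;> omega
      · beta_reduce at h'
        have h3 : (f t : ℕ) % 2 ^ d = f t' % 2 ^ d := by
          rw [← hφ, ← hφ]
          exact congrArg (fun v => ((ψ v : Fin p) : ℕ)) h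
        have := hmod (f t)
        have := hmod (f t')
        have := Nat.mod_lt (f t : ℕ) (show 2 ^ d > 0 by positivity)
        refine h2 t t' (Fin.ext ?_) ?_
        · split_ifs at h' <;> omega
        · split_ifs at h' <;> omega
    · intro t t' h h'
      rw [ne_eq, Fin.ext_iff, Function.comp_apply, Function.comp_apply, hφ] at h h'
      rw [Fin.ext_iff, Fin.ext_iff, Function.comp_apply, Function.comp_apply, Function.comp_apply,
        Function.comp_apply, hφ, hφ]
      have := hmod (f t)
      have := hmod (f t')
      omega
  have up : ∀ f : T → V, FibersLE f (2 * M) → FibersLE (ψ ∘ f) (2 * M) := by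
    rintro f ⟨idx, h1, h2⟩
    exact ⟨idx, h1, fun t t' h => h2 t t' (hψ h)⟩
  have hM : M ≤ 2 * M := by omega
  have := ((Routes.of_move (hf.mono hM) (up _ (fold f hf).1) (fold f hf).2).trans
    ((h (2 * M) T _ _ (fold f hf).1 (fold g hg).1).comp_injective hψ)).trans
    (Routes.of_move (up _ (fold g hg).1) (hg.mono hM) (fold g hg).2.symm)
  rwa [show 2 * d + 2 = 1 + 2 * d + 1 by omega]

/-- Tokens that carry rows are routed by a copy scheme. -/
theorem Routes.copies {p M R : ℕ} {U : Type} [Finite T] {f g : T → Fin p} (h : Routes M R f g)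
    (row : T → U) (S : Fin p → Set U) (hS : ∀ t, row t ∈ S (f t)) :
    Copies S R (fun _ => R * (2 * M)) (fun d => {u | ∃ t, g t = d ∧ row t = u}) := by
  classical
  have := Fintype.ofFinite T
  obtain ⟨pos, h1, h2, h3, h4⟩ := h
  have main : ∀ j ≤ R, Copies S j (fun _ => j * (2 * M))
      (fun d => {u | ∃ t, pos j t = d ∧ row t = u}) := by
    intro j
    induction j with
    | zero =>
      intro _
      refine Copies.refl _ _ ?_
      rintro d u ⟨t, rfl, rfl⟩
      rw [h1]
      exact hS t
    | succ j ih =>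
      intro hj
      have hm := h4 j (by omega)
      refine ((ih (by omega)).trans (copies_round _
        (fun q d => ∃ t, pos (j + 1) t ≠ pos j t ∧ pos j t = q ∧ pos (j + 1) t = d)
        (fun q => (Finset.univ.filter (pos j · = q)).image row) M ?_ ?_ ?_ ?_)).mono le_rfl ?_ ?_
      · rintro q d d' ⟨t, h5, h6, h7⟩ ⟨t', h5', h6', h7'⟩
        rw [← h7, ← h7']
        exact (hm t t' h5 h5').1 (h6.trans h6'.symm)
      · rintro q q' d ⟨t, h5, h6, h7⟩ ⟨t', h5', h6', h7'⟩
        rw [← h6, ← h6']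
        exact (hm t t' h5 h5').2 (h7.trans h7'.symm)
      · intro q d _ u hu
        simp only [Finset.coe_image, Finset.coe_filter, Finset.mem_univ, true_and] at hu
        exact hu
      · intro q
        exact Finset.card_image_le.trans ((h3 j (by omega)).card_le q)
      · intro q
        simp only [Pi.add_apply]
        rw [add_mul, one_mul]
      · rintro d u ⟨t, rfl, rfl⟩
        by_cases h5 : pos (j + 1) t = pos j t
        · exact Or.inl ⟨t, h5.symm, rfl⟩
        · refine Or.inr ⟨pos j t, ⟨t, h5, rfl, rfl⟩, ?_⟩
          exact Finset.mem_image_of_mem _ (by simp)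
  have := main R le_rfl
  rwa [h2] at this

end Routing

end ArrowSpMM

namespace ArrowSpMM

/-! ### Consecutive intervals -/

/-- Sum of the lengths of the intervals before the `i`-th one. -/
def prefixSum {N : ℕ} (len : Fin N → ℕ) (i : Fin N) : ℕ := ∑ j ∈ Finset.Iio i, len j

theorem prefixSum_add {N : ℕ} (len : Fin N → ℕ) (i : Fin N) :
    prefixSum len i + len i = ∑ j ∈ Finset.Iic i, len j := by
  rw [prefixSum, ← Finset.Iio_insert, Finset.sum_insert (by simp), add_comm]

theorem prefixSum_add_le {N : ℕ} (len : Fin N → ℕ) {i j : Fin N} (h : i < j) :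
    prefixSum len i + len i ≤ prefixSum len j := by
  rw [prefixSum_add]
  refine Finset.sum_le_sum_of_subset fun x hx => ?_
  simp only [Finset.mem_Iic, Finset.mem_Iio] at hx ⊢
  exact hx.trans_lt h

theorem prefixSum_add_le_sum {N : ℕ} (len : Fin N → ℕ) (i : Fin N) :
    prefixSum len i + len i ≤ ∑ j, len j := by
  rw [prefixSum_add]
  exact Finset.sum_le_sum_of_subset (Finset.subset_univ _)

theorem prefixSum_separated {N : ℕ} (len : Fin N → ℕ) {i j : Fin N} (h : i ≠ j) :
    prefixSum len i + len i ≤ prefixSum len j ∨ prefixSum len j + len j ≤ prefixSum len i := by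
  rcases lt_or_gt_of_ne h with h | h
  · exact Or.inl (prefixSum_add_le len h)
  · exact Or.inr (prefixSum_add_le len h)

theorem disjointIntervals_prefixSum {N : ℕ} (len : Fin N → ℕ) :
    DisjointIntervals (prefixSum len) len := by
  intro i i' x h1 h2 h3 h4
  by_contra hne
  rcases prefixSum_separated len hne with h | h <;> omega

/-! ### Balancing with helpers -/

theorem exists_fiber_index {T V : Type} [Fintype T] [DecidableEq V] (f : T → V) :
    ∃ idx : T → ℕ, (∀ t, idx t < (Finset.univ.filter (f · = f t)).card) ∧
      ∀ t t', f t = f t' → idx t = idx t' → t = t' := by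
  let e := fun v => (Finset.univ.filter (f · = v)).equivFin
  refine ⟨fun t => e (f t) ⟨t, by simp⟩, fun t => Fin.isLt _, fun t t' h h' => ?_⟩
  have key : ∀ v v' (hv : f t = v) (hv' : f t' = v'), v = v' →
      (e v ⟨t, by simpa using hv⟩ : ℕ) = e v' ⟨t', by simpa using hv'⟩ → t = t' := by
    rintro v v' hv hv' rfl h1
    exact congrArg Subtype.val ((e v).injective (Fin.ext h1))
  exact key _ _ rfl rfl h h'

/-- Every processor `q` gets an interval of helpers, disjoint from those of the others, such that
the tokens can be distributed with at most `2 * m` tokens on each processor. -/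
theorem exists_helpers {T : Type} [Fintype T] {p m : ℕ} (hm : 1 ≤ m)
    (hT : Fintype.card T ≤ p * m) (f : T → Fin p) :
    ∃ a len : Fin p → ℕ, DisjointIntervals a len ∧ (∀ q, a q + len q ≤ p) ∧
      ∃ g : T → Fin p, FibersLE g (2 * m) ∧
        ∀ t, g t = f t ∨ a (f t) ≤ g t ∧ (g t : ℕ) < a (f t) + len (f t) := by
  classical
  let len : Fin p → ℕ := fun q => (Finset.univ.filter (f · = q)).card / m
  have hsum : ∑ q, len q ≤ p := by
    refine le_of_mul_le_mul_right ?_ (Nat.lt_of_lt_of_le Nat.zero_lt_one hm)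
    rw [Finset.sum_mul]
    refine (Finset.sum_le_sum fun q _ => Nat.div_mul_le_self _ m).trans ?_
    rw [← Finset.card_eq_sum_card_fiberwise (fun t _ => Finset.mem_coe.2 (Finset.mem_univ (f t)))]
    exact hT
  have hle : ∀ q, prefixSum len q + len q ≤ p := fun q => (prefixSum_add_le_sum len q).trans hsum
  have hdisj := disjointIntervals_prefixSum len
  obtain ⟨idx, h1, h2⟩ := exists_fiber_index f
  obtain ⟨r, hr⟩ : ∃ r : T → ℕ, ∀ t, r t = idx t / m := ⟨_, fun _ => rfl⟩
  let g : T → Fin p := fun t => if h : r t < len (f t) then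
    ⟨prefixSum len (f t) + r t, by have := hle (f t); omega⟩ else f t
  have g1 : ∀ t, r t < len (f t) → (g t : ℕ) = prefixSum len (f t) + r t := by
    intro t h
    simp only [g, dif_pos h]
  have g2 : ∀ t, ¬ r t < len (f t) → g t = f t := fun t h => dif_neg h
  refine ⟨prefixSum len, len, hdisj, hle, g, ?_, fun t => ?_⟩
  -- Tokens present as guests are numbered below `m`, the processor's own remaining tokens from `m`
  -- on.
  · refine ⟨fun t => if r t < len (f t) then idx t % m else m + idx t % m, fun t => ?_,
      fun t t' h h' => ?_⟩
    · have := Nat.mod_lt (idx t) hm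
      beta_reduce
      split_ifs <;> omega
    · have i1 := Nat.mod_lt (idx t) hm
      have i2 := Nat.mod_lt (idx t') hm
      have e1 := Nat.div_add_mod (idx t) m
      rw [← hr] at e1
      have e2 := Nat.div_add_mod (idx t') m
      rw [← hr] at e2
      beta_reduce at h'
      split_ifs at h' with c1 c2 c2
      · have h3 := g1 t c1
        have h4 := g1 t' c2
        rw [h] at h3
        have h5 := hdisj (f t) (f t') (g t') (by omega) (by omega) (by omega) (by omega)
        rw [← h5] at h4
        have h6 : r t = r t' := by omega
        refine h2 t t' h5 ?_
        rw [← e1, ← e2, h6, h']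
      · omega
      · omega
      · rw [g2 t c1, g2 t' c2] at h
        have h3 : r t ≤ len (f t) := (hr t).le.trans <| Nat.div_le_div_right (h1 t).le
        have h4 : r t' ≤ len (f t') := (hr t').le.trans <| Nat.div_le_div_right (h1 t').le
        rw [← h] at h4 c2
        have h6 : r t = r t' := by omega
        refine h2 t t' h ?_
        rw [← e1, ← e2, h6]
        omega
  · by_cases h : r t < len (f t)
    · have := g1 t h
      exact Or.inr ⟨by omega, by omega⟩
    · exact Or.inl (g2 t h)

/-- Every processor sends rows to all its helpers. -/
theorem copies_to_helpers {p W : ℕ} {U : Type} {a len : Fin p → ℕ} (h : DisjointIntervals a len)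
    (S : Fin p → Set U) (X : Fin p → Finset U) (hW : ∀ q, (X q).card ≤ W)
    (hX : ∀ q, ↑(X q) ⊆ S q) :
    Copies S (1 + 2 * Nat.log 2 p) (fun _ => 6 * W)
      (fun t => S t ∪ {u | ∃ q, a q ≤ t ∧ (t : ℕ) < a q + len q ∧ u ∈ X q}) := by
  -- The helpers of `q` need not include `q`, so a direct round first brings the rows to the first
  -- helper. The condition `0 < len q` matters: empty intervals may start at the same place.
  refine ((copies_round S (fun q d => (d : ℕ) = a q ∧ 0 < len q) X W ?_ ?_ (fun q _ _ => hX q)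
    hW).trans (copies_broadcast h _ X W hW ?_)).mono le_rfl ?_ ?_
  · rintro q d d' ⟨h1, -⟩ ⟨h2, -⟩
    exact Fin.ext (h1.trans h2.symm)
  · rintro q q' d ⟨h1, h2⟩ ⟨h3, h4⟩
    exact h q q' d (by omega) (by omega) (by omega) (by omega)
  · exact fun q t h1 h2 u hu => Or.inr ⟨q, ⟨h1, h2⟩, hu⟩
  · intro t
    simp only [Pi.add_apply]
    omega
  · rintro t u (hu | hu)
    · exact Or.inl (Or.inl hu)
    · exact Or.inr hu

/-- Every processor collects rows from its helpers. -/
theorem copies_from_helpers {p W : ℕ} {U : Type} {a len : Fin p → ℕ} (h : DisjointIntervals a len)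
    (S : Fin p → Set U) (X : Fin p → Finset U) (hW : ∀ q, (X q).card ≤ W) :
    Copies S (2 * Nat.log 2 p + 1) (fun _ => 6 * W)
      (fun t => S t ∪ {u | u ∈ X t ∧ ∃ t' : Fin p, a t ≤ t' ∧ (t' : ℕ) < a t + len t ∧ u ∈ S t'}) := by
  classical
  have h1 := copies_gather h S X W hW
  set T : Fin p → Set U := fun t => S t ∪ {u | ∃ i, (t : ℕ) = a i ∧ u ∈ X i ∧
        ∃ t' : Fin p, a i ≤ t' ∧ (t' : ℕ) < a i + len i ∧ u ∈ S t'} with hT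
  let rows : Fin p → Finset U := fun t =>
    if h : ∃ i, (t : ℕ) = a i ∧ 0 < len i then (X h.choose).filter (· ∈ T t) else ∅
  have hrows : ∀ (t : Fin p) i, (t : ℕ) = a i → 0 < len i → rows t = (X i).filter (· ∈ T t) := by
    intro t i h2 h3
    have h4 : ∃ i, (t : ℕ) = a i ∧ 0 < len i := ⟨i, h2, h3⟩
    have h5 : rows t = (X h4.choose).filter (· ∈ T t) := dif_pos h4
    obtain ⟨h6, h7⟩ := h4.choose_spec
    rw [h5, h h4.choose i t (by omega) (by omega) (by omega) (by omega)]
  have h2 := copies_round T (fun q d => (q : ℕ) = a d ∧ 0 < len d) rows W ?_ ?_ ?_ ?_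
  · refine (h1.trans h2).mono le_rfl ?_ ?_
    · intro t
      simp only [Pi.add_apply]
      omega
    · rintro t u (hu | ⟨hu, t', h3, h4, h5⟩)
      · exact Or.inl (Or.inl hu)
      · refine Or.inr ⟨⟨a t, by omega⟩, ⟨rfl, by omega⟩, ?_⟩
        rw [hrows _ t rfl (by omega)]
        exact Finset.mem_filter.2 ⟨hu, Or.inr ⟨t, rfl, hu, t', h3, h4, h5⟩⟩
  · rintro q d d' ⟨h2, h3⟩ ⟨h4, h5⟩
    exact h d d' q (by omega) (by omega) (by omega) (by omega)
  · rintro q q' d ⟨h2, -⟩ ⟨h3, -⟩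
    exact Fin.ext (h2.trans h3.symm)
  · rintro q d ⟨h2, h3⟩ u hu
    rw [hrows q d h2 h3] at hu
    exact (Finset.mem_filter.1 hu).2
  · intro q
    by_cases h3 : ∃ i, (q : ℕ) = a i ∧ 0 < len i
    · obtain ⟨i, h3, h4⟩ := h3
      rw [hrows q i h3 h4]
      exact (Finset.card_filter_le _ _).trans (hW i)
    · have h4 : rows q = ∅ := dif_neg h3
      rw [h4]
      exact Nat.zero_le _

/-- Transport of `Fintype.card T ≤ p * m` row copies from arbitrary sources to arbitrary targets,
given a solution of balanced routing problems with at most `2 * m` tokens per processor. -/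
theorem copies_transport {T U : Type} [Fintype T] {p m M R W : ℕ} (hm : 1 ≤ m)
    (hT : Fintype.card T ≤ p * m)
    (hroute : ∀ f g : T → Fin p, FibersLE f (2 * m) → FibersLE g (2 * m) → Routes M R f g)
    (f g : T → Fin p) (row : T → U) (S : Fin p → Set U) (X Y : Fin p → Finset U)
    (hX : ∀ q, (X q).card ≤ W) (hY : ∀ q, (Y q).card ≤ W) (hXS : ∀ q, ↑(X q) ⊆ S q)
    (hXf : ∀ t, row t ∈ X (f t)) (hYg : ∀ t, row t ∈ Y (g t)) :
    Copies S (4 * Nat.log 2 p + 2 + R) (fun _ => 12 * W + R * (2 * M))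
      (fun d => {u | ∃ t, g t = d ∧ row t = u}) := by
  -- Only the balanced problem from `f'` to `g'` is routed; `f` and `g` may be very uneven, and the
  -- trees on the helpers absorb this at a volume of `O(W)`.
  obtain ⟨a, len, h1, h2, f', hf', hff'⟩ := exists_helpers hm hT f
  obtain ⟨a', len', h1', h2', g', hg', hgg'⟩ := exists_helpers hm hT g
  have c1 := copies_to_helpers h1 S X hX hXS
  have c2 := (hroute f' g' hf' hg').copies row (fun t => S t ∪
    {u | ∃ q, a q ≤ t ∧ (t : ℕ) < a q + len q ∧ u ∈ X q}) (by
      intro t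
      rcases hff' t with h3 | ⟨h3, h4⟩
      · rw [h3]
        exact Or.inl (hXS _ (hXf t))
      · exact Or.inr ⟨f t, h3, h4, hXf t⟩)
  have c3 := copies_from_helpers h1' (fun d => {u | ∃ t, g' t = d ∧ row t = u}) Y hY
  refine ((c1.trans c2).trans c3).mono (by omega) ?_ ?_
  · intro t
    simp only [Pi.add_apply]
    omega
  · rintro d u ⟨t, rfl, rfl⟩
    rcases hgg' t with h3 | ⟨h3, h4⟩
    · exact Or.inl ⟨t, h3, rfl⟩
    · exact Or.inr ⟨hYg t, g' t, h3, h4, t, rfl, rfl⟩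

end ArrowSpMM

namespace ArrowSpMM

/-! ### Arrow matrices laid out in tiles -/

theorem card_tile_le {T : Type} [Fintype T] {pos : T → ℕ} (hpos : Function.Injective pos) {τ : ℕ}
    (hτ : 0 < τ) (t : ℕ) : (Finset.univ.filter fun v => pos v / τ = t).card ≤ τ := by
  refine le_trans ?_ (Finset.card_range τ).le
  refine Finset.card_le_card_of_injOn (fun v => pos v % τ) (fun v _ => ?_) ?_
  · simpa using Nat.mod_lt (pos v) hτ
  · intro v hv w hw e
    simp only [Finset.coe_filter, Finset.mem_univ, true_and, Set.mem_ofPred_eq] at hv hw e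
    refine hpos ?_
    rw [← Nat.div_add_mod (pos v) τ, ← Nat.div_add_mod (pos w) τ, hv, hw, e]

/-- Vertices are laid out at the positions `pos`, in tiles of size `τ`, and the level `i` occupies
the interval `[a i, a i + len i)`. If each processor holds the rows of its tile, copying brings
together the rows of any two vertices of the same level that are at distance at most `b` or one of
which is among the first `b` of its level. -/
theorem copies_arrow {p b τ : ℕ} {T U ι : Type} [Finite T] (lev : T → ι) (row : T → U)
    (pos : T → ℕ) (hpos : Function.Injective pos) (a len : ι → ℕ)
    (hsep : ∀ i j, i ≠ j → a i + len i ≤ a j ∨ a j + len j ≤ a i)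
    (hlen : ∀ i, a i + len i ≤ p * τ)
    (hlev : ∀ v, a (lev v) ≤ pos v ∧ pos v < a (lev v) + len (lev v)) (hb : b ≤ τ) (hτ : 0 < τ)
    (S : Fin p → Set U) (hS : ∀ v (t : Fin p), (t : ℕ) = pos v / τ → row v ∈ S t) :
    ∃ S' : Fin p → Set U, Copies S (2 + 2 * Nat.log 2 p) (fun _ => 8 * τ) S' ∧
      ∀ v w, lev v = lev w → (pos v < a (lev v) + b ∨ pos w < a (lev w) + b ∨
        pos v ≤ pos w + b ∧ pos w ≤ pos v + b) → ∃ t, row v ∈ S' t ∧ row w ∈ S' t := by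
  classical
  have := Fintype.ofFinite T
  let X : Fin p → Finset U := fun t => (Finset.univ.filter fun v => pos v / τ = t).image row
  let Z : ι → Finset U := fun i =>
    (Finset.univ.filter fun v => lev v = i ∧ pos v < a i + b).image row
  have hX : ∀ t, (X t).card ≤ τ := by
    intro t
    exact Finset.card_image_le.trans (card_tile_le hpos hτ t)
  have hZ : ∀ i, (Z i).card ≤ τ := by
    intro i
    refine Finset.card_image_le.trans (le_trans ?_ hb)
    refine le_trans ?_ (Finset.card_range b).le
    refine Finset.card_le_card_of_injOn (fun v => pos v - a i) (fun v hv => ?_) ?_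
    · simp only [Finset.coe_filter, Finset.mem_univ, true_and, Set.mem_ofPred_eq] at hv
      have := hlev v
      rw [hv.1] at this
      simp only [Finset.coe_range, Set.mem_Iio]
      omega
    · intro v hv w hw e
      simp only [Finset.coe_filter, Finset.mem_univ, true_and, Set.mem_ofPred_eq] at hv hw e
      have h1 := hlev v
      have h2 := hlev w
      rw [hv.1] at h1
      rw [hw.1] at h2
      exact hpos (by omega)
  have hXmem : ∀ v (t : Fin p), pos v / τ = t → row v ∈ X t := by
    intro v t h
    exact Finset.mem_image_of_mem _ (by simpa using h)
  have hXS : ∀ t, ↑(X t) ⊆ S t := by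
    intro t u hu
    obtain ⟨v, hv, rfl⟩ := Finset.mem_image.1 hu
    exact hS v t (Finset.mem_filter.1 hv).2.symm
  have htile : ∀ v, pos v / τ < p := by
    intro v
    rw [Nat.div_lt_iff_lt_mul hτ]
    exact (hlev v).2.trans_le (hlen _)
  let lo : ι → ℕ := fun i => a i / τ
  let hi : ι → ℕ := fun i => (a i + len i - 1) / τ
  have hbetween : ∀ v, lo (lev v) ≤ pos v / τ ∧ pos v / τ ≤ hi (lev v) := by
    intro v
    have := hlev v
    exact ⟨Nat.div_le_div_right this.1, Nat.div_le_div_right (by omega)⟩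
  have hhead : ∀ v, pos v < a (lev v) + b → pos v / τ ≤ lo (lev v) + 1 := by
    intro v hv
    rw [← Nat.add_div_right _ hτ]
    exact Nat.div_le_div_right (by omega)
  -- Consecutive levels may share a boundary tile, and many short levels may lie in one tile.
  -- Omitting the first tile `lo i` makes the intervals disjoint; it and `lo i + 1` are served by
  -- the exchange between neighbours, since the head of a level lies in these two tiles.
  have hdisj : DisjointIntervals (fun i => lo i + 1) (fun i => hi i - lo i) := by
    intro i j x h1 h2 h3 h4
    by_contra hne
    have key : ∀ i j, a i + len i ≤ a j → hi i ≤ lo j := fun i j h =>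
      Nat.div_le_div_right (by omega)
    beta_reduce at h1 h2 h3 h4
    rcases hsep i j hne with h | h
    · have := key i j h
      omega
    · have := key j i h
      omega
  have c1 := copies_round S (fun q d => (d : ℕ) = q + 1) X τ
    (fun q d d' h h' => Fin.ext (h.trans h'.symm)) (fun q q' d h h' => Fin.ext (by omega))
    (fun q _ _ => hXS q) hX
  have c12 := c1.trans (copies_round _ (fun q d => (q : ℕ) = d + 1) X τ
    (fun q d d' h h' => Fin.ext (by omega)) (fun q q' d h h' => Fin.ext (h.trans h'.symm))
    (fun q _ _ u hu => Or.inl (hXS q hu)) hX)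
  set S₂ : Fin p → Set U := fun d => (S d ∪ {u | ∃ q : Fin p, (d : ℕ) = q + 1 ∧ u ∈ X q}) ∪
    {u | ∃ q : Fin p, (q : ℕ) = d + 1 ∧ u ∈ X q} with hS₂
  have near : ∀ v (t : Fin p), pos v / τ ≤ t + 1 → t ≤ pos v / τ + 1 → row v ∈ S₂ t := by
    intro v t h1 h2
    have h3 := htile v
    rcases Nat.lt_trichotomy (pos v / τ) t with h4 | h4 | h4
    · exact Or.inl (Or.inr ⟨⟨pos v / τ, h3⟩, by simp only []; omega, hXmem v _ rfl⟩)
    · exact Or.inl (Or.inl (hS v t h4.symm))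
    · exact Or.inr ⟨⟨pos v / τ, h3⟩, by simp only []; omega, hXmem v _ rfl⟩
  have c3 := copies_broadcast hdisj S₂ Z τ hZ (by
    rintro i t h1 - u hu
    obtain ⟨v, hv, rfl⟩ := Finset.mem_image.1 hu
    obtain ⟨-, rfl, hv⟩ := Finset.mem_filter.1 hv
    have := hhead v hv
    have := hbetween v
    exact near v t (by omega) (by omega))
  refine ⟨_, (c12.trans c3).mono (by omega) (fun t => ?_) le_rfl, ?_⟩
  · simp only [Pi.add_apply]
    omega
  have head : ∀ v w, lev v = lev w → pos v < a (lev v) + b → ∀ t : Fin p, pos w / τ = t →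
      row v ∈ (S₂ t ∪ {u | ∃ i, lo i + 1 ≤ t ∧ (t : ℕ) < lo i + 1 + (hi i - lo i) ∧ u ∈ Z i}) := by
    intro v w hvw hv t ht
    have h1 := hbetween w
    have h2 := hhead v hv
    have h3 := hbetween v
    rw [← hvw] at h1
    by_cases h4 : pos w / τ = lo (lev v)
    · exact Or.inl (near v t (by omega) (by omega))
    · refine Or.inr ⟨lev v, by omega, by omega, Finset.mem_image_of_mem _ ?_⟩
      simpa using hv
  intro v w hvw h
  rcases h with h | h | ⟨h, h'⟩
  · exact ⟨⟨pos w / τ, htile w⟩, head v w hvw h _ rfl, Or.inl (near w _ (by simp) (by simp))⟩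
  · exact ⟨⟨pos v / τ, htile v⟩, Or.inl (near v _ (by simp) (by simp)), head w v hvw.symm h _ rfl⟩
  · refine ⟨⟨pos v / τ, htile v⟩, Or.inl (near v _ (by simp) (by simp)), Or.inl (near w _ ?_ ?_)⟩
    · simp only []
      rw [← Nat.add_div_right _ hτ]
      exact Nat.div_le_div_right (by omega)
    · simp only []
      rw [← Nat.add_div_right _ hτ]
      exact Nat.div_le_div_right (by omega)

end ArrowSpMM

namespace ArrowSpMM

/-! ### Copying from blocks of rows -/

/-- Every processor gets the rows of `δ` consecutive blocks. -/
theorem copies_coarsen {p s δ : ℕ} {U : Type} [Finite U] {pos : U → ℕ}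
    (hpos : Function.Injective pos) (hs : 0 < s) (hδ : 0 < δ) (hp : ∀ u, pos u < p * s) :
    Copies (fun q : Fin p => {u | pos u / s = q}) δ (fun _ => δ * (2 * s))
      (fun d => {u | pos u / (s * δ) = d}) := by
  classical
  have := Fintype.ofFinite U
  have main : ∀ r ≤ δ, Copies (fun q : Fin p => {u | pos u / s = q}) r (fun _ => r * (2 * s))
      ((fun q : Fin p => {u | pos u / s = q}) ⊔
        fun d => {u | pos u / s / δ = d ∧ pos u / s % δ < r}) := by
    intro r
    induction r with
    | zero =>
      intro _
      refine Copies.refl _ _ ?_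
      rintro d u (hu | ⟨-, hu⟩)
      · exact hu
      · exact absurd hu (Nat.not_lt_zero _)
    | succ r ih =>
      intro hr
      -- In round `r` every `d` receives the `r`-th of its `δ` blocks, so senders and recipients are
      -- matched.
      refine ((ih (by omega)).trans (copies_round _ (fun q d => (q : ℕ) = δ * d + r)
        (fun q => Finset.univ.filter fun u => pos u / s = q) s ?_ ?_ ?_ ?_)).mono le_rfl ?_ ?_
      · intro q d d' h h'
        refine Fin.ext (Nat.eq_of_mul_eq_mul_left hδ ?_)
        omega
      · exact fun q q' d h h' => Fin.ext (h.trans h'.symm)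
      · intro q d _ u hu
        exact Or.inl (by simpa using hu)
      · exact fun q => card_tile_le hpos hs q
      · intro t
        simp only [Pi.add_apply]
        rw [add_mul, one_mul]
      · rintro d u (hu | ⟨h1, h2⟩)
        · exact Or.inl (Or.inl hu)
        · rcases Nat.lt_succ_iff_lt_or_eq.1 h2 with h3 | h3
          · exact Or.inl (Or.inr ⟨h1, h3⟩)
          · refine Or.inr ⟨⟨pos u / s, (Nat.div_lt_iff_lt_mul hs).2 (hp u)⟩, ?_, by simp⟩
            have := Nat.div_add_mod (pos u / s) δ
            rw [h1, h3] at this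
            exact this.symm
  refine (main δ le_rfl).mono le_rfl le_rfl ?_
  intro d u hu
  refine Or.inr ⟨?_, Nat.mod_lt _ hδ⟩
  rw [Nat.div_div_eq_div_mul]
  exact hu

/-- Every processor gets all rows. -/
theorem copies_all {p s : ℕ} {U : Type} [Finite U] {pos : U → ℕ}
    (hpos : Function.Injective pos) (hs : 0 < s) (hp : ∀ u, pos u < p * s) :
    Copies (fun q : Fin p => {u | pos u / s = q}) (p - 1) (fun _ => (p - 1) * (2 * s))
      (fun _ => Set.univ) := by
  classical
  have := Fintype.ofFinite U
  have main : ∀ r < p, Copies (fun q : Fin p => {u | pos u / s = q}) r (fun _ => r * (2 * s))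
      ((fun q : Fin p => {u | pos u / s = q}) ⊔
        fun d => {u | ∃ i ≤ r, (pos u / s + i) % p = d}) := by
    intro r
    induction r with
    | zero =>
      intro _
      refine Copies.refl _ _ ?_
      rintro d u (hu | ⟨i, hi, hu⟩)
      · exact hu
      · obtain rfl : i = 0 := by omega
        rw [add_zero, Nat.mod_eq_of_lt ((Nat.div_lt_iff_lt_mul hs).2 (hp u))] at hu
        exact hu
    | succ r ih =>
      intro hr
      -- Each round is a cyclic shift, in which every processor sends its own block.
      refine ((ih (by omega)).trans (copies_round _ (fun q d => ((q : ℕ) + (r + 1)) % p = d)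
        (fun q => Finset.univ.filter fun u => pos u / s = q) s ?_ ?_ ?_ ?_)).mono le_rfl ?_ ?_
      · exact fun q d d' h h' => Fin.ext (h.symm.trans h')
      · intro q q' d h h'
        have h1 : (q : ℕ) + (r + 1) ≡ q' + (r + 1) [MOD p] := h.trans h'.symm
        have h2 := Nat.ModEq.add_right_cancel' _ h1
        refine Fin.ext ?_
        rwa [Nat.ModEq, Nat.mod_eq_of_lt q.2, Nat.mod_eq_of_lt q'.2] at h2
      · intro q d _ u hu
        exact Or.inl (by simpa using hu)
      · exact fun q => card_tile_le hpos hs q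
      · intro t
        simp only [Pi.add_apply]
        rw [add_mul, one_mul]
      · rintro d u (hu | ⟨i, h1, h2⟩)
        · exact Or.inl (Or.inl hu)
        · rcases Nat.lt_or_ge i (r + 1) with h3 | h3
          · exact Or.inl (Or.inr ⟨i, by omega, h2⟩)
          · obtain rfl : i = r + 1 := by omega
            exact Or.inr ⟨⟨pos u / s, (Nat.div_lt_iff_lt_mul hs).2 (hp u)⟩, h2, by simp⟩
  rcases Nat.eq_zero_or_pos p with rfl | hp0
  · exact Copies.refl _ _ fun d => d.elim0
  refine (main (p - 1) (by omega)).mono le_rfl le_rfl ?_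
  intro d u _
  have hu : pos u / s < p := (Nat.div_lt_iff_lt_mul hs).2 (hp u)
  refine Or.inr ⟨(d + p - pos u / s) % p, ?_, ?_⟩
  · have := Nat.mod_lt (d + p - pos u / s) hp0
    omega
  · rw [Nat.add_mod_mod, show pos u / s + (d + p - pos u / s) = d + p by omega,
      Nat.add_mod_right, Nat.mod_eq_of_lt d.2]

/-! ### The active part of an arrow matrix -/

open Classical in
/-- The indices of the nonzero rows and columns. -/
noncomputable def activeSet {n : ℕ} (B : Matrix (Fin n) (Fin n) ℝ) : Finset (Fin n) :=
  Finset.univ.filter fun y => (∃ z, B y z ≠ 0) ∨ ∃ z, B z y ≠ 0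

theorem left_mem_activeSet {n : ℕ} {B : Matrix (Fin n) (Fin n) ℝ} {y z : Fin n} (h : B y z ≠ 0) :
    y ∈ activeSet B := by
  classical
  exact Finset.mem_filter.2 ⟨Finset.mem_univ _, Or.inl ⟨z, h⟩⟩

theorem right_mem_activeSet {n : ℕ} {B : Matrix (Fin n) (Fin n) ℝ} {y z : Fin n} (h : B y z ≠ 0) :
    z ∈ activeSet B := by
  classical
  exact Finset.mem_filter.2 ⟨Finset.mem_univ _, Or.inr ⟨y, h⟩⟩

theorem card_activeSet_le {n : ℕ} (B : Matrix (Fin n) (Fin n) ℝ) :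
    (activeSet B).card ≤ nonzeroRows B + nonzeroCols B := by
  classical
  have h : (activeSet B : Set (Fin n)) = {i | ∃ j, B i j ≠ 0} ∪ {j | ∃ i, B i j ≠ 0} := by
    ext y
    simp [activeSet]
  rw [← Set.ncard_coe_finset, h]
  exact Set.ncard_union_le _ _

theorem nonzeroRows_le_nnz {n : ℕ} (B : Matrix (Fin n) (Fin n) ℝ) : nonzeroRows B ≤ nnz B := by
  have h : {i : Fin n | ∃ j, B i j ≠ 0} = Prod.fst '' {e : Fin n × Fin n | B e.1 e.2 ≠ 0} := by
    ext i
    simp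
  rw [nonzeroRows, nnz, h]
  exact Set.ncard_image_le (Set.toFinite _)

theorem nonzeroCols_le_nnz {n : ℕ} (B : Matrix (Fin n) (Fin n) ℝ) : nonzeroCols B ≤ nnz B := by
  have h : {j : Fin n | ∃ i, B i j ≠ 0} = Prod.snd '' {e : Fin n × Fin n | B e.1 e.2 ≠ 0} := by
    ext i
    simp
  rw [nonzeroCols, nnz, h]
  exact Set.ncard_image_le (Set.toFinite _)

theorem nonzeroRows_le {n : ℕ} (B : Matrix (Fin n) (Fin n) ℝ) : nonzeroRows B ≤ n := by
  have := Set.ncard_le_card {i : Fin n | ∃ j, B i j ≠ 0}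
  rwa [Nat.card_eq_fintype_card, Fintype.card_fin] at this

theorem nonzeroCols_le {n : ℕ} (B : Matrix (Fin n) (Fin n) ℝ) : nonzeroCols B ≤ n := by
  have := Set.ncard_le_card {j : Fin n | ∃ i, B i j ≠ 0}
  rwa [Nat.card_eq_fintype_card, Fintype.card_fin] at this

/-- The number of elements of `t` below `y`. -/
def rank {n : ℕ} (t : Finset (Fin n)) (y : Fin n) : ℕ := (t.filter (· < y)).card

theorem rank_lt_card {n : ℕ} {t : Finset (Fin n)} {y : Fin n} (h : y ∈ t) : rank t y < t.card :=
  Finset.card_lt_card ((Finset.filter_ssubset).2 ⟨y, h, lt_irrefl y⟩)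

theorem rank_lt_rank {n : ℕ} {t : Finset (Fin n)} {y z : Fin n} (h : y ∈ t) (hyz : y < z) :
    rank t y < rank t z := by
  refine Finset.card_lt_card ((Finset.ssubset_iff_of_subset fun w hw => ?_).2 ⟨y, ?_, ?_⟩)
  · rw [Finset.mem_filter] at hw ⊢
    exact ⟨hw.1, hw.2.trans hyz⟩
  · exact Finset.mem_filter.2 ⟨h, hyz⟩
  · simp

theorem rank_injOn {n : ℕ} {t : Finset (Fin n)} {y z : Fin n} (hy : y ∈ t) (hz : z ∈ t)
    (h : rank t y = rank t z) : y = z := by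
  rcases lt_trichotomy y z with h1 | h1 | h1
  · exact absurd h (rank_lt_rank hy h1).ne
  · exact h1
  · exact absurd h (rank_lt_rank hz h1).ne'

theorem rank_le {n : ℕ} (t : Finset (Fin n)) (y : Fin n) : rank t y ≤ y := by
  refine (Finset.card_le_card (t := Finset.Iio y) fun w hw => ?_).trans (Fin.card_Iio y).le
  exact Finset.mem_Iio.2 (Finset.mem_filter.1 hw).2

/-- At most `b` indices lie from `y` up to `z`, so packing the active indices does not stretch the
band. -/
theorem rank_le_rank_add {n b : ℕ} (t : Finset (Fin n)) {y z : Fin n} (h : (z : ℕ) ≤ y + b) :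
    rank t z ≤ rank t y + b := by
  have h1 : t.filter (· < z) ⊆ t.filter (· < y) ∪ Finset.Ico y z := by
    intro w hw
    rw [Finset.mem_filter] at hw
    rw [Finset.mem_union, Finset.mem_filter, Finset.mem_Ico]
    rcases lt_or_ge w y with h2 | h2
    · exact Or.inl ⟨hw.1, h2⟩
    · exact Or.inr ⟨h2, hw.2⟩
  refine (Finset.card_le_card h1).trans ((Finset.card_union_le _ _).trans ?_)
  rw [Fin.card_Ico]
  exact Nat.add_le_add_left (by omega) _

theorem HasArrowWidth.cases {n b : ℕ} {B : Matrix (Fin n) (Fin n) ℝ} (h : HasArrowWidth B b)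
    {y z : Fin n} (hyz : B y z ≠ 0) :
    (y : ℕ) < b ∨ (z : ℕ) < b ∨ (y : ℕ) ≤ z + b ∧ (z : ℕ) ≤ y + b := by
  by_contra hc
  have h1 := abs_le.1 (h y z (by omega) (by omega) hyz)
  omega

/-! ### The copy scheme of a decomposition -/

/-- The rows of all nonzero entries of the first matrix are brought together. -/
theorem copies_first_level {n b p s δ : ℕ} {B : Matrix (Fin n) (Fin n) ℝ} (hB : HasArrowWidth B b)
    (σ : Equiv.Perm (Fin n)) (hs : 0 < s) (hδ : 0 < δ) (hn : n ≤ p * s) (hb : b ≤ s * δ) :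
    ∃ S : Fin p → Set (Fin n), Copies (fun q : Fin p => {u | (σ u : ℕ) / s = q})
      (δ + (2 + 2 * Nat.log 2 p)) (fun _ => 10 * (s * δ)) S ∧
      ∀ v w, B (σ v) (σ w) ≠ 0 → ∃ t, v ∈ S t ∧ w ∈ S t := by
  have hpos : Function.Injective fun u => (σ u : ℕ) := Fin.val_injective.comp σ.injective
  have hlt : ∀ u, (σ u : ℕ) < p * s := fun u => (σ u).2.trans_le hn
  have hpτ : p * s ≤ p * (s * δ) := Nat.mul_le_mul_left _ (Nat.le_mul_of_pos_right _ hδ)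
  obtain ⟨S, h1, h2⟩ := copies_arrow (p := p) (b := b) (τ := s * δ) (fun _ : Fin n => ()) id
    (fun u => (σ u : ℕ)) hpos (fun _ => 0) (fun _ => n) (fun i j h => absurd rfl h)
    (fun _ => by omega) (fun v => ⟨Nat.zero_le _, by simp⟩) hb (Nat.mul_pos hs hδ)
    (fun d => {u | (σ u : ℕ) / (s * δ) = d}) (fun v t h => h.symm)
  refine ⟨S, ((copies_coarsen hpos hs hδ hlt).trans h1).mono le_rfl (fun t => ?_) le_rfl,
    fun v w hvw => ?_⟩
  · simp only [Pi.add_apply]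
    have : δ * (2 * s) = 2 * (s * δ) := by ring
    omega
  · refine h2 v w rfl ?_
    have := hB.cases hvw
    omega

/-- The rows of all nonzero entries of the other matrices are brought together. -/
theorem copies_other_levels {n b p s l m M R τ : ℕ} {B : Fin l → Matrix (Fin n) (Fin n) ℝ}
    (hB : ∀ i, HasArrowWidth (B i) b) (σ : Equiv.Perm (Fin n)) (π : Fin l → Equiv.Perm (Fin n))
    (hs : 0 < s) (hn : n ≤ p * s) (hb : b ≤ τ) (hsτ : s ≤ τ) (hm : 1 ≤ m)
    (hpm : ∑ i, (activeSet (B i)).card ≤ p * m) (hpτ : ∑ i, (activeSet (B i)).card ≤ p * τ)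
    (hroute : ∀ (T : Type) [Finite T] (f g : T → Fin p), FibersLE f (2 * m) → FibersLE g (2 * m) →
      Routes M R f g) :
    ∃ S : Fin p → Set (Fin n), Copies (fun q : Fin p => {u | (σ u : ℕ) / s = q})
      (4 * Nat.log 2 p + 2 + R + (2 + 2 * Nat.log 2 p)) (fun _ => 20 * τ + R * (2 * M)) S ∧
      ∀ i v w, B i (π i v) (π i w) ≠ 0 → ∃ t, v ∈ S t ∧ w ∈ S t := by
  classical
  have hτ : 0 < τ := by omega
  -- One token for each level and active index: a row active on several levels has several tokens.
  let T : Type := Σ i : Fin l, {y // y ∈ activeSet (B i)}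
  let len : Fin l → ℕ := fun i => (activeSet (B i)).card
  let row : T → Fin n := fun v => (π v.1).symm v.2
  let pos : T → ℕ := fun v => prefixSum len v.1 + rank (activeSet (B v.1)) v.2
  have hlev : ∀ v : T, prefixSum len v.1 ≤ pos v ∧ pos v < prefixSum len v.1 + len v.1 :=
    fun v => ⟨Nat.le_add_right _ _, Nat.add_lt_add_left (rank_lt_card v.2.2) _⟩
  have hinj : Function.Injective pos := by
    intro v w hvw
    have h1 := hlev v
    have h2 := hlev w
    have h3 := disjointIntervals_prefixSum len v.1 w.1 (pos v) h1.1 h1.2 (by omega) (by omega)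
    obtain ⟨i, y, hy⟩ := v
    obtain ⟨j, z, hz⟩ := w
    obtain rfl : i = j := h3
    have h4 : y = z := rank_injOn hy hz (Nat.add_left_cancel hvw)
    subst h4
    rfl
  have hle : ∀ i, prefixSum len i + len i ≤ p * τ := fun i =>
    (prefixSum_add_le_sum len i).trans hpτ
  have htile : ∀ v, pos v / τ < p := fun v =>
    (Nat.div_lt_iff_lt_mul hτ).2 ((hlev v).2.trans_le (hle _))
  have hσ : Function.Injective fun u => (σ u : ℕ) := Fin.val_injective.comp σ.injective
  have hT : Fintype.card T = ∑ i, (activeSet (B i)).card := by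
    simp [T, Fintype.card_sigma]
  have c1 := copies_transport hm (hT.le.trans hpm) (hroute T)
    (fun v => ⟨(σ (row v) : ℕ) / s, (Nat.div_lt_iff_lt_mul hs).2 ((σ (row v)).2.trans_le hn)⟩)
    (fun v => ⟨pos v / τ, htile v⟩) row (fun q : Fin p => {u | (σ u : ℕ) / s = q})
    (fun q => Finset.univ.filter fun u => (σ u : ℕ) / s = q)
    (fun q => (Finset.univ.filter fun v => pos v / τ = q).image row) (W := τ)
    (fun q => (card_tile_le hσ hs q).trans hsτ)
    (fun q => Finset.card_image_le.trans (card_tile_le hinj hτ q))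
    (fun q u hu => by simpa using hu) (fun v => by simp)
    (fun v => Finset.mem_image_of_mem _ (by simp))
  obtain ⟨S, h1, h2⟩ := copies_arrow (p := p) (b := b) (τ := τ) (fun v : T => v.1) row pos hinj
    (prefixSum len) len (fun i j h => prefixSum_separated len h) hle hlev hb hτ
    (fun d => {u | ∃ v, (⟨pos v / τ, htile v⟩ : Fin p) = d ∧ row v = u})
    (fun v t h => ⟨v, Fin.ext h.symm, rfl⟩)
  refine ⟨S, (c1.trans h1).mono le_rfl (fun t => ?_) le_rfl, fun i v w hvw => ?_⟩
  · simp only [Pi.add_apply]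
    omega
  · have h3 := h2 ⟨i, π i v, left_mem_activeSet hvw⟩ ⟨i, π i w, right_mem_activeSet hvw⟩ rfl ?_
    · simpa only [row, Equiv.symm_apply_apply] using h3
    · have h4 := rank_le (activeSet (B i)) (π i v)
      have h5 := rank_le (activeSet (B i)) (π i w)
      simp only [pos]
      rcases (hB i).cases hvw with h | h | ⟨h, h'⟩
      · omega
      · omega
      · have h6 := rank_le_rank_add (activeSet (B i)) h
        have h7 := rank_le_rank_add (activeSet (B i)) h'
        omega

/-- Terms may cancel in the sum, but a nonzero entry of `A` cannot arise from zero entries only. -/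
theorem ArrowDecomposition.exists_ne_zero {n b l : ℕ} {A : Matrix (Fin n) (Fin n) ℝ}
    (D : ArrowDecomposition A b l) {v w : Fin n} (h : A v w ≠ 0) :
    ∃ i, D.B i (D.π i v) (D.π i w) ≠ 0 := by
  have key : ∀ i, ((D.π i).permMatrix ℝ * D.B i * ((D.π i).permMatrix ℝ)ᵀ) v w =
      D.B i (D.π i v) (D.π i w) := by
    intro i
    simp [Matrix.mul_apply, Equiv.Perm.permMatrix, PEquiv.toMatrix_apply, Equiv.toPEquiv_apply,
      Equiv.symm_apply_eq]
  have hA : A v w = ∑ i, D.B i (D.π i v) (D.π i w) := by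
    conv_lhs => rw [D.sum_eq]
    rw [Matrix.sum_apply]
    exact Finset.sum_congr rfl fun i _ => key i
  rw [hA] at h
  obtain ⟨i, -, hi⟩ := Finset.exists_ne_zero_of_sum_ne_zero h
  exact ⟨i, hi⟩

/-- The rows of all nonzero entries are brought together. -/
theorem ArrowDecomposition.exists_copies {n b p s l m M R δ : ℕ} {A : Matrix (Fin n) (Fin n) ℝ}
    (D : ArrowDecomposition A b l) (hs : 0 < s) (hδ : 0 < δ) (hn : n ≤ p * s) (hb : b ≤ s * δ)
    (hm : 1 ≤ m) (hpm : ∑ i : Fin l, (activeSet (D.B i.succ)).card ≤ p * m)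
    (hps : ∑ i : Fin l, (activeSet (D.B i.succ)).card ≤ p * s)
    (hroute : ∀ (T : Type) [Finite T] (f g : T → Fin p), FibersLE f (2 * m) → FibersLE g (2 * m) →
      Routes M R f g) :
    ∃ S : Fin p → Set (Fin n), Copies (fun q : Fin p => {u | (D.π 0 u : ℕ) / s = q})
      (δ + 6 + 8 * Nat.log 2 p + R) (fun _ => 30 * (s * δ) + R * (2 * M)) S ∧
      ∀ v w, A v w ≠ 0 → ∃ t, v ∈ S t ∧ w ∈ S t := by
  have hsδ : s ≤ s * δ := Nat.le_mul_of_pos_right _ hδ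
  obtain ⟨S, h1, h2⟩ := copies_first_level (D.arrow 0) (D.π 0) hs hδ hn hb
  obtain ⟨S', h1', h2'⟩ := copies_other_levels (fun i : Fin l => D.arrow i.succ) (D.π 0)
    (fun i => D.π i.succ) hs hn hb hsδ hm hpm (hps.trans (Nat.mul_le_mul_left _ hsδ)) hroute
  refine ⟨S' ⊔ S, (h1.keep.trans (h1'.frame S)).mono (by omega) (fun t => ?_) le_rfl, ?_⟩
  · simp only [Pi.add_apply]
    omega
  · intro v w h
    obtain ⟨i, hi⟩ := D.exists_ne_zero h
    induction i using Fin.cases with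
    | zero =>
      obtain ⟨t, h3, h4⟩ := h2 v w hi
      exact ⟨t, Or.inr h3, Or.inr h4⟩
    | succ i =>
      obtain ⟨t, h3, h4⟩ := h2' i v w hi
      exact ⟨t, Or.inl h3, Or.inl h4⟩

end ArrowSpMM

namespace ArrowSpMM

/-! ### Bounds -/

/-- Only the first ratio is kept as `1 / x`; all later ones are bounded by `1 / 2`, so the tail
gains the full factor `1 / x`. -/
theorem sum_succ_le_of_geometric {l : ℕ} {x Y : ℝ} (hx : 2 ≤ x) (y : Fin (l + 1) → ℝ)
    (hY : 0 ≤ Y) (h0 : y 0 ≤ Y) (h : ∀ i : Fin l, y i.succ ≤ 1 / x * y i.castSucc) :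
    ∑ i : Fin l, y i.succ ≤ 2 * Y / x := by
  have hx0 : 0 < x := by linarith
  have hx1 : 1 / x ≤ 1 / 2 := one_div_le_one_div_of_le two_pos hx
  have hx2 : 0 ≤ 1 / x := by positivity
  have h1 : ∀ i : Fin (l + 1), y i ≤ Y * (1 / 2) ^ (i : ℕ) := by
    intro i
    induction i using Fin.induction with
    | zero => simpa using h0
    | succ i ih =>
      have h2 : 0 ≤ Y * (1 / 2 : ℝ) ^ (i : ℕ) := by positivity
      calc y i.succ ≤ 1 / x * y i.castSucc := h i
        _ ≤ 1 / x * (Y * (1 / 2) ^ (i : ℕ)) := mul_le_mul_of_nonneg_left ih hx2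
        _ ≤ 1 / 2 * (Y * (1 / 2) ^ (i : ℕ)) := mul_le_mul_of_nonneg_right hx1 h2
        _ = Y * (1 / 2) ^ ((i.succ : Fin (l + 1)) : ℕ) := by
          rw [Fin.val_succ, pow_succ]
          ring
  calc ∑ i : Fin l, y i.succ ≤ ∑ i : Fin l, 1 / x * (Y * (1 / 2) ^ (i : ℕ)) :=
        Finset.sum_le_sum fun i _ => (h i).trans (mul_le_mul_of_nonneg_left (h1 _) hx2)
    _ = 1 / x * (Y * ∑ i ∈ Finset.range l, (1 / 2 : ℝ) ^ i) := by
        rw [← Finset.mul_sum, ← Finset.mul_sum, Fin.sum_univ_eq_sum_range (fun i => (1 / 2 : ℝ) ^ i)]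
    _ ≤ 1 / x * (Y * 2) := by
        have := sum_geometric_two_le l
        gcongr
    _ = 2 * Y / x := by ring

/-- The total size of the active parts of all matrices but the first. -/
theorem ArrowDecomposition.sum_card_activeSet_le {n b l : ℕ} {A : Matrix (Fin n) (Fin n) ℝ}
    (D : ArrowDecomposition A b l) {x C : ℝ} (hx : 2 ≤ x) (hC : 0 ≤ C)
    (h : D.RowColCompacting x ∨ D.EntryCompacting x ∧ (nnz (D.B 0) : ℝ) ≤ C * n) :
    ((∑ i : Fin l, (activeSet (D.B i.succ)).card : ℕ) : ℝ) ≤ 4 * (C + 1) * n / x := by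
  have hx0 : 0 < x := by linarith
  have hcard : ∀ B : Matrix (Fin n) (Fin n) ℝ,
      ((activeSet B).card : ℝ) ≤ nonzeroRows B + nonzeroCols B := fun B => by
    exact_mod_cast card_activeSet_le B
  have hn : (0 : ℝ) ≤ n := Nat.cast_nonneg n
  push_cast
  rcases h with h | ⟨h, h0⟩
  · have h1 := sum_succ_le_of_geometric hx (fun i => (nonzeroRows (D.B i) : ℝ)) hn
      (by exact_mod_cast nonzeroRows_le _) (fun i => (h i).1)
    have h2 := sum_succ_le_of_geometric hx (fun i => (nonzeroCols (D.B i) : ℝ)) hn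
      (by exact_mod_cast nonzeroCols_le _) (fun i => (h i).2)
    refine (Finset.sum_le_sum fun i _ => hcard (D.B (Fin.succ i))).trans ?_
    rw [Finset.sum_add_distrib]
    refine (add_le_add h1 h2).trans ?_
    rw [← add_div]
    refine div_le_div_of_nonneg_right ?_ hx0.le
    nlinarith
  · have h1 := sum_succ_le_of_geometric hx (fun i => (nnz (D.B i) : ℝ)) (by positivity) h0 h
    have h2 : ∀ B : Matrix (Fin n) (Fin n) ℝ, ((activeSet B).card : ℝ) ≤ 2 * nnz B := fun B => by
      have h3 := card_activeSet_le B
      have h4 := nonzeroRows_le_nnz B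
      have h5 := nonzeroCols_le_nnz B
      have : (activeSet B).card ≤ 2 * nnz B := by omega
      exact_mod_cast this
    refine (Finset.sum_le_sum fun i _ => h2 (D.B (Fin.succ i))).trans ?_
    rw [← Finset.mul_sum]
    refine (mul_le_mul_of_nonneg_left h1 two_pos.le).trans ?_
    rw [← mul_div_assoc]
    refine div_le_div_of_nonneg_right ?_ hx0.le
    nlinarith

theorem natLog_two_le_two_mul_log {p : ℕ} (hp : 1 ≤ p) :
    (Nat.log 2 p : ℝ) ≤ 2 * Real.log p := by
  have h1 : ((2 ^ Nat.log 2 p : ℕ) : ℝ) ≤ p := by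
    exact_mod_cast Nat.pow_log_le_self 2 (by omega)
  have h2 := Real.log_le_log (by positivity) h1
  rw [Nat.cast_pow, Real.log_pow, Nat.cast_ofNat] at h2
  have h3 := Real.log_two_gt_d9
  have h4 : (0 : ℝ) ≤ Nat.log 2 p := Nat.cast_nonneg _
  nlinarith

theorem half_le_log {p : ℕ} (hp : 2 ≤ p) : 1 / 2 ≤ Real.log p := by
  have h1 : (2 : ℝ) ≤ p := by exact_mod_cast hp
  have h2 := Real.log_le_log two_pos h1
  have h3 := Real.log_two_gt_d9
  linarith

/-- A bounded number of processors can afford to exchange everything. -/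
theorem exists_copies_of_log_sq_le {n p s : ℕ} (σ : Equiv.Perm (Fin n)) (hp : 1 ≤ p) (hs : 0 < s)
    (hn : n ≤ p * s) {G : ℝ} (hG : Real.log p ^ 2 ≤ G) :
    ∃ R V : ℕ, Copies (fun q : Fin p => {u | (σ u : ℕ) / s = q}) R (fun _ => V)
      (fun _ => Set.univ) ∧ (R : ℝ) ≤ 4 * Real.exp √G * Real.log p ^ 2 ∧
      (V : ℝ) ≤ 2 * Real.exp √G * s := by
  have hpG : (p : ℝ) ≤ Real.exp √G := by
    rw [← Real.log_le_iff_le_exp (by exact_mod_cast hp)]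
    exact Real.le_sqrt_of_sq_le hG
  have hp1 : ((p - 1 : ℕ) : ℝ) ≤ Real.exp √G :=
    le_trans (by exact_mod_cast Nat.sub_le p 1) hpG
  refine ⟨p - 1, (p - 1) * (2 * s), copies_all (Fin.val_injective.comp σ.injective) hs
    (fun u => (σ u).2.trans_le hn), ?_, ?_⟩
  · rcases Nat.lt_or_ge 1 p with h | h
    · have h1 := half_le_log h
      have h2 : 1 ≤ 4 * Real.log p ^ 2 := by nlinarith
      calc ((p - 1 : ℕ) : ℝ) ≤ Real.exp √G := hp1
        _ ≤ Real.exp √G * (4 * Real.log p ^ 2) := le_mul_of_one_le_right (Real.exp_pos _).le h2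
        _ = _ := by ring
    -- Here the bound vanishes, as `log 1 = 0`, and indeed no rounds are used.
    · obtain rfl : p = 1 := by omega
      simp
  · push_cast
    calc ((p - 1 : ℕ) : ℝ) * (2 * s) ≤ Real.exp √G * (2 * s) :=
          mul_le_mul_of_nonneg_right hp1 (by positivity)
      _ = _ := by ring

/-- On many processors, the decomposition is so compacting that all its matrices but the first can
be transported at no extra cost. -/
theorem ArrowDecomposition.exists_copies_of_le_log_sq {n b p s l δ : ℕ}
    {A : Matrix (Fin n) (Fin n) ℝ} (D : ArrowDecomposition A b l) (hp : 2 ≤ p) (hs : 0 < s)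
    (hδ : 0 < δ) (hn : n ≤ p * s) (hb : b ≤ s * δ) {x c C : ℝ} (hc : 0 < c) (hC : 0 < C)
    (hx : c * Real.log p ^ 2 ≤ x) (hG : 4 * (C + 1) ≤ c * Real.log p ^ 2)
    (h : D.RowColCompacting x ∨ D.EntryCompacting x ∧ (nnz (D.B 0) : ℝ) ≤ C * n) :
    ∃ (R V : ℕ) (S : Fin p → Set (Fin n)),
      Copies (fun q : Fin p => {u | (D.π 0 u : ℕ) / s = q}) R (fun _ => V) S ∧
      (∀ v w, A v w ≠ 0 → ∃ t, v ∈ S t ∧ w ∈ S t) ∧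
      (R : ℝ) ≤ (4 * δ + 72 + 16 * (4 * (C + 1) / c + 1) ^ 2) * Real.log p ^ 2 ∧
      (V : ℝ) ≤ (30 * δ + 32 * (4 * (C + 1) / c + 1) ^ 3 + 128 * (4 * (C + 1) / c + 1)) * s := by
  set L := Real.log p with hL
  set G := 4 * (C + 1) / c with hGdef
  have hL1 : 1 / 2 ≤ L := half_le_log hp
  have hL2 : 1 ≤ 4 * L ^ 2 := by nlinarith
  have hL0 : 0 < L ^ 2 := by positivity
  have hlog : (Nat.log 2 p : ℝ) ≤ 4 * L ^ 2 := by
    have := natLog_two_le_two_mul_log (show 1 ≤ p by omega)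
    nlinarith
  have hG0 : 0 < G := by positivity
  have hp0 : (0 : ℝ) < p := by exact_mod_cast (show 0 < p by omega)
  have hs1 : (1 : ℝ) ≤ s := by exact_mod_cast hs
  have hnR : (n : ℝ) ≤ p * s := by exact_mod_cast hn
  have hx0 : 0 < x := lt_of_lt_of_le (by positivity) hx
  have hsum := D.sum_card_activeSet_le (by linarith) hC.le h
  set N := ∑ i : Fin l, (activeSet (D.B i.succ)).card with hN
  -- The packed layout fits into the tiles because `x` is at least `4 * (C + 1)`.
  have hNn : N ≤ n := by
    have h1 : (N : ℝ) ≤ n := by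
      refine hsum.trans ?_
      rw [div_le_iff₀ hx0, mul_comm]
      exact mul_le_mul_of_nonneg_left (hG.trans hx) (Nat.cast_nonneg n)
    exact_mod_cast h1
  have hNp : (N : ℝ) / p ≤ G * s / L ^ 2 := by
    rw [div_le_iff₀ hp0]
    calc (N : ℝ) ≤ 4 * (C + 1) * n / x := hsum
      _ ≤ 4 * (C + 1) * (p * s) / (c * L ^ 2) := by gcongr
      _ = G * s / L ^ 2 * p := by
        rw [hGdef]
        field_simp
  obtain ⟨m, hm⟩ : ∃ m, m = N / p + 1 := ⟨_, rfl⟩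
  have hm1 : 1 ≤ m := (Nat.le_add_left 1 _).trans hm.ge
  have hmR : (m : ℝ) ≤ G * s / L ^ 2 + 1 := by
    rw [hm]
    push_cast
    exact add_le_add_left (Nat.cast_div_le.trans hNp) 1
  have hNm : N ≤ p * m := by
    rw [hm, mul_add, mul_one]
    have := Nat.div_add_mod N p
    have := Nat.mod_lt N (show p > 0 by omega)
    omega
  have hm0 : (0 : ℝ) ≤ m := Nat.cast_nonneg m
  -- The summand `1` in `m` decides the route: for small `s` the load is at most `G + 1` and direct
  -- sending takes boundedly many rounds; for large `s` the summand is absorbed by `s / L ^ 2`, and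
  -- logarithmically many rounds of load `O(m)` are affordable.
  rcases le_total (s : ℝ) (L ^ 2) with hsL | hsL
  · have hmG : (m : ℝ) ≤ G + 1 := by
      refine hmR.trans (add_le_add_left ?_ 1)
      rw [div_le_iff₀ hL0]
      exact mul_le_mul_of_nonneg_left hsL hG0.le
    obtain ⟨S, h1, h2⟩ := D.exists_copies (p := p) hs hδ hn hb hm1 hNm
      (hNn.trans hn) (fun T _ f g hf hg => Routes.direct hf hg)
    refine ⟨_, _, S, h1, h2, ?_, ?_⟩
    · have h3 : (m : ℝ) ^ 2 ≤ (G + 1) ^ 2 := pow_le_pow_left₀ hm0 hmG 2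
      push_cast
      have h4 : ((δ : ℝ) + 6 + 4 * (G + 1) ^ 2) * 1 ≤
          ((δ : ℝ) + 6 + 4 * (G + 1) ^ 2) * (4 * L ^ 2) :=
        mul_le_mul_of_nonneg_left hL2 (by positivity)
      nlinarith
    · have h3 : (m : ℝ) ^ 3 ≤ (G + 1) ^ 3 := pow_le_pow_left₀ hm0 hmG 3
      push_cast
      have h4 : 32 * (G + 1) ^ 3 * 1 ≤ 32 * (G + 1) ^ 3 * (s : ℝ) :=
        mul_le_mul_of_nonneg_left hs1 (by positivity)
      have h5 : 0 ≤ 128 * (G + 1) * (s : ℝ) := by positivity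
      nlinarith
  · have hmG : L ^ 2 * m ≤ (G + 1) * s := by
      have h3 : L ^ 2 * m ≤ L ^ 2 * (G * s / L ^ 2 + 1) := mul_le_mul_of_nonneg_left hmR hL0.le
      rw [mul_add, mul_div_cancel₀ _ hL0.ne'] at h3
      linarith
    obtain ⟨S, h1, h2⟩ := D.exists_copies (p := p) hs hδ hn hb hm1 hNm
      (hNn.trans hn) (fun T _ f g hf hg => Routes.logarithmic (by omega) hf hg)
    refine ⟨_, _, S, h1, h2, ?_, ?_⟩
    · push_cast
      have h4 : ((δ : ℝ) + 8) * 1 ≤ ((δ : ℝ) + 8) * (4 * L ^ 2) :=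
        mul_le_mul_of_nonneg_left hL2 (by positivity)
      have h5 : 0 ≤ 16 * (G + 1) ^ 2 * L ^ 2 := by positivity
      nlinarith
    · push_cast
      have h4 : (2 * (Nat.log 2 p : ℝ) + 2) * (m * 8) ≤ (16 * L ^ 2) * (m * 8) :=
        mul_le_mul_of_nonneg_right (by linarith) (by positivity)
      have h5 : 0 ≤ 32 * (G + 1) ^ 3 * (s : ℝ) := by positivity
      nlinarith

end ArrowSpMM

/-! ### Choice of the constants and assembly -/

theorem mainTheorem1 (c c₁ c₂ c₃ C : ℝ) (hc : 0 < c) (hc₁ : 0 < c₁) (hc₂ : 0 < c₂)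
    (hc₃ : 0 < c₃) (hC : 0 < C) :
    ∃ K : ℝ, 0 < K ∧
      ∀ (n k b p s l : ℕ) (x : ℝ) (A : Matrix (Fin n) (Fin n) ℝ)
        (D : ArrowSpMM.ArrowDecomposition A b l),
        1 ≤ b → 1 ≤ p →
        c₁ * ((n : ℝ) / (b : ℝ)) ≤ (p : ℝ) → (p : ℝ) ≤ c₂ * ((n : ℝ) / (b : ℝ)) →
        n ≤ p * s → (s : ℝ) ≤ c₃ * (b : ℝ) →
        0 < x → c * Real.log (p : ℝ) ^ 2 ≤ x →
        (D.RowColCompacting x ∨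
          (D.EntryCompacting x ∧ (ArrowSpMM.nnz (D.B 0) : ℝ) ≤ C * (n : ℝ))) →
        ∃ a : ArrowSpMM.Algorithm p (ArrowSpMM.Form n k),
          ArrowSpMM.Computes a s ((D.π 0).permMatrix ℝ)ᵀ (((D.π 0).permMatrix ℝ)ᵀ * A) ∧
          ∀ α β : ℝ, 0 ≤ α → 0 ≤ β →
            a.cost α β ≤
              K * (α * Real.log (p : ℝ) ^ 2 + β * ((n : ℝ) * (k : ℝ) / (p : ℝ))) := by
  set δ := ⌈c₂⌉₊ with hδdef
  set G := 4 * (C + 1) / c with hGdef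
  have hδ : 0 < δ := Nat.ceil_pos.2 hc₂
  have hG : 0 < G := by positivity
  set K₁ : ℝ := 4 * Real.exp √G + (4 * δ + 72 + 16 * (G + 1) ^ 2) with hK₁
  set K₂ : ℝ := 2 * Real.exp √G + (30 * δ + 32 * (G + 1) ^ 3 + 128 * (G + 1)) with hK₂
  have hK₁0 : 0 < K₁ := by positivity
  have hK₂0 : 0 < K₂ := by positivity
  refine ⟨2 * K₁ + 2 * (K₂ * (c₃ * c₂)), by positivity, ?_⟩
  intro n k b p s l x A D hb hp _ hp₂ hn hs₃ _ hx h
  have hbR : (0 : ℝ) < b := by exact_mod_cast hb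
  have hpR : (0 : ℝ) < p := by exact_mod_cast hp
  have hbp : (b : ℝ) * p ≤ c₂ * n := by
    rw [← mul_div_assoc, le_div_iff₀ hbR] at hp₂
    linarith
  have hnR : (n : ℝ) ≤ p * s := by exact_mod_cast hn
  -- A block can be shorter than `b`, but only by the factor `c₂`; thus `δ = ⌈c₂⌉₊` blocks form a
  -- tile of at least `b` rows.
  have hbs : (b : ℝ) ≤ c₂ * s := by
    refine le_of_mul_le_mul_right ?_ hpR
    calc (b : ℝ) * p ≤ c₂ * n := hbp
      _ ≤ c₂ * (p * s) := mul_le_mul_of_nonneg_left hnR hc₂.le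
      _ = c₂ * s * p := by ring
  have hs : 0 < s := by
    rcases Nat.eq_zero_or_pos s with rfl | hs
    · simp at hbs
      omega
    · exact hs
  have hbδ : b ≤ s * δ := by
    have h1 : (b : ℝ) ≤ s * δ := by
      refine hbs.trans ?_
      rw [mul_comm]
      exact mul_le_mul_of_nonneg_left (Nat.le_ceil c₂) (Nat.cast_nonneg s)
    exact_mod_cast h1
  have hsR : (0 : ℝ) ≤ s := Nat.cast_nonneg s
  obtain ⟨R, V, S, h1, h2, h3, h4⟩ : ∃ (R V : ℕ) (S : Fin p → Set (Fin n)),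
      ArrowSpMM.Copies (fun q : Fin p => {u | (D.π 0 u : ℕ) / s = q}) R (fun _ => V) S ∧
      (∀ v w, A v w ≠ 0 → ∃ t, v ∈ S t ∧ w ∈ S t) ∧
      (R : ℝ) ≤ K₁ * Real.log p ^ 2 ∧ (V : ℝ) ≤ K₂ * s := by
    have hE := Real.exp_pos √G
    -- The threshold `G` is where `c * log² p` reaches `4 * (C + 1)`; below it the compaction gives
    -- no useful bound, but `p` is bounded.
    rcases le_total (Real.log p ^ 2) G with hL | hL
    · obtain ⟨R, V, h1, h2, h3⟩ := ArrowSpMM.exists_copies_of_log_sq_le (D.π 0) hp hs hn hL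
      refine ⟨R, V, _, h1, fun v w _ => ⟨⟨0, hp⟩, trivial, trivial⟩, h2.trans ?_, h3.trans ?_⟩
      · refine mul_le_mul_of_nonneg_right ?_ (sq_nonneg _)
        rw [hK₁]
        have : 0 ≤ 4 * (δ : ℝ) + 72 + 16 * (G + 1) ^ 2 := by positivity
        linarith
      · refine mul_le_mul_of_nonneg_right ?_ hsR
        rw [hK₂]
        have : 0 ≤ 30 * (δ : ℝ) + 32 * (G + 1) ^ 3 + 128 * (G + 1) := by positivity
        linarith
    · have hp2 : 2 ≤ p := by
        by_contra hp2
        obtain rfl : p = 1 := by omega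
        simp at hL
        linarith
      obtain ⟨R, V, S, h1, h2, h3, h4⟩ := D.exists_copies_of_le_log_sq hp2 hs hδ hn hbδ hc hC hx
        (by rwa [hGdef, div_le_iff₀ hc, mul_comm (Real.log (p : ℝ) ^ 2)] at hL) h
      refine ⟨R, V, S, h1, h2, h3.trans ?_, h4.trans ?_⟩
      · refine mul_le_mul_of_nonneg_right ?_ (sq_nonneg _)
        linarith
      · refine mul_le_mul_of_nonneg_right ?_ hsR
        linarith
  obtain ⟨a, ha1, ha2⟩ := ArrowSpMM.exists_algorithm_of_copies (k := k) A (D.π 0) S h1 h2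
  refine ⟨a, ha1, fun α β hα hβ => (ha2 α β hα hβ).trans ?_⟩
  -- Converts the volume `O(s * k)` into `O(n * k / p)`, by `s ≤ c₃ * b` and `b * p ≤ c₂ * n`.
  have hs_le : (s : ℝ) ≤ c₃ * c₂ * (n / p) := by
    rw [mul_assoc, ← mul_div_assoc]
    refine hs₃.trans (mul_le_mul_of_nonneg_left ?_ hc₃.le)
    rwa [le_div_iff₀ hpR]
  have hV : (V : ℝ) * k ≤ K₂ * (c₃ * c₂) * (n * k / p) := by
    calc (V : ℝ) * k ≤ K₂ * s * k := mul_le_mul_of_nonneg_right h4 (Nat.cast_nonneg k)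
      _ ≤ K₂ * (c₃ * c₂ * (n / p)) * k := by gcongr
      _ = _ := by ring
  have hα' : α * (2 * R) ≤ 2 * K₁ * (α * Real.log p ^ 2) := by
    have := mul_le_mul_of_nonneg_left h3 hα
    linarith
  have hβ' : β * (2 * (V * k)) ≤ 2 * (K₂ * (c₃ * c₂)) * (β * (n * k / p)) := by
    have := mul_le_mul_of_nonneg_left hV hβ
    linarith
  have h5 : 0 ≤ 2 * (K₂ * (c₃ * c₂)) * (α * Real.log p ^ 2) := by positivity
  have h6 : 0 ≤ 2 * K₁ * (β * ((n : ℝ) * k / p)) := by positivity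
  linarith
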